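/- All logarithms are to base $2$, and $c_0=\frac{1}{\log_2 5+1}\approx 0.301$. **Definitions.** A graph $G=(V,E,c)$ is a finite undirected multigraph with positive edge capacities. Let $T\subseteq V$ be a set of terminals. A demand $\mathcal D$ on $T$ assigns a number $\mathcal D_{t,t'}\ge 0$ to each unordered pair of distinct terminals, not all zero. A flow assigns a number $f_P\ge 0$ to each path $P$ between terminals; it routes $\mathcal D$ if for all distinct $t,t'\in T$ the values $f_P$ of the $t$-$t'$ paths $P$ add up to $\mathcal D_{t,t'}$. Its congestion is $\max_{e\in E}\frac{1}{c(e)}\sum_{P\ni e}f_P$, and $\mathrm{cong}_G(\mathcal D)$ is the minimum congestion of a flow in $G$ that routes $\mathcal D$ ($\infty$ if there is none). A graph $H$ containing the terminals $T$ is a flow sparsifier of $G$ with quality $q\ge 1$ if $\mathrm{cong}_H(\mathcal D)\le \mathrm{cong}_G(\mathcal D)\le q\cdot \mathrm{cong}_H(\mathcal D)$ for every demand $\mathcal D$ on $T$. We say that $H$ has quality at least $Q$ if every $q$ with this property satisfies $q\ge Q$. A contraction-based flow sparsifier of $G$ is a graph $H$ obtained from a partition $\mathcal F$ of $V$ in which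 distinct terminals lie in distinct clusters, by contracting each cluster (not necessarily connected) into one vertex, keeping parallel edges and discarding self-loops; $H$ has $|\mathcal F|$ vertices. For a probability distribution $\mu$ on the contraction-based flow sparsifiers of $G$ (a convex combination of them), the graph $H_\mu$ consists of one copy of each $H$ in the support of $\mu$, with its capacities multiplied by $\Pr_\mu[H]$, where all the copies are glued together at the terminals; the quality of $\mu$ is that of $H_\mu$. **Theorem 1.1.** There are absolute constants $C>0$ and $\varepsilon_0>0$ such that for every $0<\varepsilon<\varepsilon_0$ there is $k_0=k_0(\varepsilon)$ such that for every integer $k\ge k_0$ there exist a graph $G=(V,E,c)$ with all capacities $c(e)\ge 1$ and a set $T\subseteq V$ of $k$ terminals with the following two properties. 1. Every contraction-based flow sparsifier of $G$ with at most $k\cdot 2^{(\log k)^{(1-c_0)+\varepsilon}}$ vertices has quality at least $(\log k)^{c_0-C\varepsilon}$. 2. For every probability distribution $\mu$ on the contraction-based flow sparsifiers of $G$ such that each sparsifier in its support has at most $k\cdot 2^{(\log k)^{(1-c_0)+\varepsilon}}$ vertices, the graph $H_\mu$ has quality at least $(\log k)^{c_0-C\varepsilon}$. -/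

import Mathlib

open scoped NNReal ENNReal

/-- An undirected multigraph with vertex type `V` and edge type `E` (parallel edges are distinct
elements of `E` with the same unordered pair of ends), with positive edge capacities. -/
structure CapGraph (V E : Type) where
  /-- The unordered pair of ends of an edge. -/
  ends : E → Sym2 V
  /-- The capacity of an edge. -/
  cap : E → ℝ≥0
  cap_pos : ∀ e, 0 < cap e

namespace CapGraph

/-- Walks from `u` to `v` in `G`, recorded with the edges they use. -/
inductive Walk {V E : Type} (G : CapGraph V E) : V → V → Type
  | nil (u : V) : Walk G u u
  | cons {u v w : V} (e : E) (h : G.ends e = s(u, v)) (p : Walk G v w) : Walk G u w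

/-- The list of vertices visited by a walk. -/
def Walk.support {V E : Type} {G : CapGraph V E} : {u v : V} → Walk G u v → List V
  | u, _, .nil _ => [u]
  | u, _, .cons _ _ p => u :: p.support

/-- The list of edges used by a walk. -/
def Walk.edges {V E : Type} {G : CapGraph V E} : {u v : V} → Walk G u v → List E
  | _, _, .nil _ => []
  | _, _, .cons e _ p => e :: p.edges

/-- The `u`-`v` paths of `G`: walks without repeated vertices. -/
def Path {V E : Type} (G : CapGraph V E) (u v : V) : Type :=
  {p : Walk G u v // p.support.Nodup}

/-- All paths of `G` between terminals, where `τ` tells which vertex of `G` each terminal is.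
The same path traversed in the two directions gives two elements; a flow is summed over both. -/
structure TerminalPath {V E K : Type} (G : CapGraph V E) (τ : K → V) where
  src : K
  tgt : K
  path : Path G (τ src) (τ tgt)

end CapGraph

/-- A demand on a set `K` of terminals: a nonnegative number for each unordered pair of distinct
terminals (recorded as `0` on the diagonal), not all of them zero. -/
structure Demand (K : Type) where
  val : Sym2 K → ℝ≥0
  val_diag : ∀ t : K, val s(t, t) = 0
  exists_ne_zero : ∃ z, val z ≠ 0

namespace CapGraph

/-- A multicommodity flow: a nonnegative number for each path between terminals. -/
abbrev Flow {V E K : Type} (G : CapGraph V E) (τ : K → V) : Type :=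
  TerminalPath G τ → ℝ≥0

/-- `f` routes `D`: for any two distinct terminals `t, t'`, the total amount sent from `t` to `t'`
or from `t'` to `t` is the demand of the pair. -/
def Flow.Routes {V E K : Type} {G : CapGraph V E} {τ : K → V} (f : Flow G τ) (D : Demand K) :
    Prop :=
  ∀ t t' : K, t ≠ t' →
    (∑' P : Path G (τ t) (τ t'), (f ⟨t, t', P⟩ : ℝ≥0∞))
      + (∑' P : Path G (τ t') (τ t), (f ⟨t', t, P⟩ : ℝ≥0∞)) = (D.val s(t, t') : ℝ≥0∞)

/-- The congestion of a flow: the maximum, over all edges, of the amount of flow through the edge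
divided by the capacity of the edge. -/
noncomputable def Flow.congestion {V E K : Type} {G : CapGraph V E} {τ : K → V} (f : Flow G τ) :
    ℝ≥0∞ :=
  ⨆ e : E, (∑' P : {P : TerminalPath G τ // e ∈ P.path.1.edges}, (f P.1 : ℝ≥0∞)) / (G.cap e : ℝ≥0∞)

/-- The congestion of a demand: the least congestion of a flow that routes it
(`∞` if no flow routes it). -/
noncomputable def congestion {V E K : Type} (G : CapGraph V E) (τ : K → V) (D : Demand K) : ℝ≥0∞ :=
  ⨅ (f : Flow G τ) (_ : f.Routes D), f.congestion

/-- `H`, in which the terminals sit at the vertices `σ`, is a flow sparsifier of quality `q ≥ 1` of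
`G`, in which they sit at the vertices `τ`. -/
def IsFlowSparsifier {V E V' E' K : Type} (G : CapGraph V E) (τ : K → V)
    (H : CapGraph V' E') (σ : K → V') (q : ℝ) : Prop :=
  1 ≤ q ∧ ∀ D : Demand K,
    H.congestion σ D ≤ G.congestion τ D ∧
      G.congestion τ D ≤ ENNReal.ofReal q * H.congestion σ D

/-- The graph obtained from `G` by contracting each class of the partition `F` of its vertices
(classes need not be connected), keeping parallel edges and discarding self-loops. -/
def contract {V E : Type} (G : CapGraph V E) (F : Setoid V) :
    CapGraph (Quotient F) {e : E // ¬ ((G.ends e).map (Quotient.mk F)).IsDiag} where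
  ends e := (G.ends e.1).map (Quotient.mk F)
  cap e := G.cap e.1
  cap_pos e := G.cap_pos e.1

/-- The relation that identifies the terminal `t` with its image in each copy. -/
inductive GlueRel {ι K : Type} {V : ι → Type} (τ : ∀ i, K → V i) :
    (K ⊕ (Σ i, V i)) → (K ⊕ (Σ i, V i)) → Prop
  | terminal (t : K) (i : ι) : GlueRel τ (Sum.inl t) (Sum.inr ⟨i, τ i t⟩)

/-- Disjoint copies of the graphs `H i`, with the capacities of the `i`-th one scaled by `p i`,
glued together at the terminals. -/
def glue {ι K : Type} {V E : ι → Type} (H : ∀ i, CapGraph (V i) (E i)) (τ : ∀ i, K → V i)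
    (p : ι → ℝ≥0) (hp : ∀ i, 0 < p i) : CapGraph (Quot (GlueRel τ)) (Σ i, E i) where
  ends e := ((H e.1).ends e.2).map fun v => Quot.mk (GlueRel τ) (Sum.inr ⟨e.1, v⟩)
  cap e := p e.1 * (H e.1).cap e.2
  cap_pos e := mul_pos (hp e.1) ((H e.1).cap_pos e.2)

end CapGraph

/-- A partition of the vertices is valid if distinct terminals lie in distinct classes. -/
def ValidPartition {V : Type} (T : Finset V) (F : Setoid V) : Prop :=
  ∀ t ∈ T, ∀ t' ∈ T, F t t' → t = t'

/-- The number of classes of a partition, which is the number of vertices of the contracted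
graph. -/
noncomputable def partitionSize {V : Type} (F : Setoid V) : ℕ := Nat.card (Quotient F)

/-- The vertex of the contracted graph at which a terminal sits. -/
def contractTerminal {V : Type} (T : Finset V) (F : Setoid V) (t : T) : Quotient F :=
  Quotient.mk F t.1

/-- The graph `H_μ` of a probability distribution `μ` on the contraction-based sparsifiers of `G`,
each given by its valid partition: copies of all those in the support of `μ`, with capacities
scaled by their probabilities, glued together at the terminals. -/
noncomputable def mixtureGraph {V E : Type} (G : CapGraph V E) (T : Finset V)
    (μ : PMF {F : Setoid V // ValidPartition T F}) :=
  CapGraph.glue (ι := μ.support) (fun F => G.contract F.1.1)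
    (fun F => contractTerminal T F.1.1) (fun F => (μ F.1).toNNReal)
    (fun F => ENNReal.toNNReal_pos ((μ.mem_support_iff F.1).1 F.2) (μ.apply_ne_top F.1))

/-- The vertex of `H_μ` at which a terminal sits. -/
def mixtureTerminal {V : Type} (T : Finset V) (μ : PMF {F : Setoid V // ValidPartition T F})
    (t : T) :
    Quot (CapGraph.GlueRel (fun F : μ.support => contractTerminal T F.1.1)) :=
  Quot.mk _ (Sum.inl t)

/-- The constant `c₀ = 1 / (log₂ 5 + 1) ≈ 0.301`. -/
noncomputable def cZero : ℝ := 1 / (Real.logb 2 5 + 1)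

/-- The size bound `k · 2 ^ ((log₂ k) ^ ((1 - c₀) + ε))`. -/
noncomputable def sizeBound (k : ℕ) (ε : ℝ) : ℝ :=
  (k : ℝ) * (2 : ℝ) ^ (Real.logb 2 (k : ℝ) ^ ((1 - cZero) + ε))

/-! The hard instance is a Cayley graph of degree `2 r`, without nontrivial relations of length at
most `2 R`, where `R` is a constant fraction of `L = log k`. It has `N`, about `k * 2 ^ A`, vertices
and edge capacities `M`. The terminals form a net, and an edge of capacity one joins each vertex to
a terminal at distance at most `r₀`. Give Cayley edges length 1 and the other edges length `r₀`. By
weak duality, demands routable in `G` with congestion `q` have total (demand times distance) at most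
`q` times the volume `N * (r * M + r₀)`. So it suffices to route in every small contraction, with
congestion one, demands of total distance at least `Q` times the volume (`CarriesLength`). This
passes to convex combinations (`CarriesLength.glue`).

With few classes, an average class is much larger than a ball of radius `ρ 0`, so resampling a
vertex uniformly in its class moves it by more than `ρ 0` with average probability at least 1/2. Let
`Ψ i` be the expected number of vertices moved by more than `ρ i`, for scales `ρ 0, …, ρ I` with
ratios at most `L ^ ε`. By `exists_scale` there are two cases.

If `Ψ I` is still of order `N / 16 ^ I`, many pairs of identified vertices are at distance more than
`ρ I`, and these are joined at no cost in Cayley edges (`carriesLength_of_farMass`).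

Otherwise `Ψ (i + 1) ≤ Ψ i / 16` for some `i`. Most vertices then lie within `ρ (i + 1)` of a centre
of their class, while jumps inside classes still often exceed `ρ i`. Chains alternate Cayley edges
with free jumps inside classes, about `R / ρ (i + 1)` times (`exists_chain`). Large girth makes the
relevant balls trees. A tree argument (`card_occupied_le`) shows that, on average, a class is seen
in at most two directions from each of its vertices; without those directions the words of a chain
concatenate without cancellation, and lengths add up. The total is of order `N * R * ρ i / ρ (i +
1)`, up to powers of 16 (`carriesLength_of_scale`).

With `a = L ^ (1 - c₀ + ε)`, the volume is `O(N * a)` for fixed `ε`, and both cases give length at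
least of order `N * L ^ (1 - ε)`. The spare factor `L ^ ε` absorbs the constants and leaves quality
`L ^ (c₀ - 3 * ε)`. -/

set_option linter.unusedSectionVars false

/-! ### Walks, weak duality for multicommodity flows, and gluing. -/

namespace CapGraph

variable {V E K Ω : Type}

/-- `u` and `v` are joined by a walk of `G` all of whose edges lie in `U`. -/
def Joins (G : CapGraph V E) (u v : V) (U : Set E) : Prop :=
  ∃ w : Walk G u v, ∀ e ∈ w.edges, e ∈ U

theorem Joins.refl (G : CapGraph V E) (u : V) : G.Joins u u ∅ :=
  ⟨.nil u, by simp [Walk.edges]⟩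

theorem Joins.mono {G : CapGraph V E} {u v : V} {A B : Set E} (h : G.Joins u v A) (hAB : A ⊆ B) :
    G.Joins u v B := by
  obtain ⟨w, hw⟩ := h
  exact ⟨w, fun e he => hAB (hw e he)⟩

theorem Joins.of_edge {G : CapGraph V E} {u v : V} {e : E} (h : G.ends e = s(u, v)) :
    G.Joins u v {e} :=
  ⟨.cons e h (.nil v), by simp [Walk.edges]⟩

theorem Joins.trans {G : CapGraph V E} {u v w : V} {A B : Set E} (h₁ : G.Joins u v A)
    (h₂ : G.Joins v w B) : G.Joins u w (A ∪ B) := by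
  obtain ⟨p, hp⟩ := h₁
  induction p with
  | nil u => exact h₂.mono Set.subset_union_right
  | @cons u v' w' e he p ih =>
    obtain ⟨q, hq⟩ := ih h₂ fun e' h' => hp e' (by simp [Walk.edges, h'])
    refine ⟨.cons e he q, fun e' h' => ?_⟩
    rcases List.mem_cons.1 h' with rfl | h'
    · exact Or.inl (hp _ (by simp [Walk.edges]))
    · exact hq e' h'

theorem Walk.exists_suffix {G : CapGraph V E} {u v : V} (p : Walk G u v) :
    ∀ x ∈ p.support, ∃ q : Walk G x v, q.support <:+ p.support ∧ q.edges <:+ p.edges := by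
  induction p with
  | nil u =>
    intro x hx
    obtain rfl : x = u := by simpa [Walk.support] using hx
    exact ⟨.nil x, List.suffix_rfl, List.suffix_rfl⟩
  | @cons u v w e h p ih =>
    intro x hx
    rcases List.mem_cons.1 hx with rfl | hx
    · exact ⟨.cons e h p, List.suffix_rfl, List.suffix_rfl⟩
    · obtain ⟨q, h₁, h₂⟩ := ih x hx
      exact ⟨q, h₁.trans (List.suffix_cons _ _), h₂.trans (List.suffix_cons _ _)⟩

theorem Joins.exists_path {G : CapGraph V E} {u v : V} {A : Set E} (h : G.Joins u v A) :
    ∃ P : Path G u v, ∀ e ∈ P.1.edges, e ∈ A := by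
  obtain ⟨p, hp⟩ := h
  induction p with
  | nil u => exact ⟨⟨.nil u, by simp [Walk.support]⟩, hp⟩
  | @cons u v w e h p ih =>
    obtain ⟨P, hP⟩ := ih fun e' h' => hp e' (by simp [Walk.edges, h'])
    by_cases hu : u ∈ P.1.support
    · obtain ⟨q, h₁, h₂⟩ := P.1.exists_suffix u hu
      exact ⟨⟨q, P.2.sublist h₁.sublist⟩, fun e' h' => hP e' (h₂.subset h')⟩
    · refine ⟨⟨.cons e h P.1, List.nodup_cons.2 ⟨hu, P.2⟩⟩, fun e' h' => ?_⟩
      rcases List.mem_cons.1 h' with rfl | h'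
      · exact hp _ (by simp [Walk.edges])
      · exact hP e' h'

theorem Walk.start_mem_support {G : CapGraph V E} {u v : V} (p : Walk G u v) : u ∈ p.support := by
  cases p <;> simp [Walk.support]

theorem Walk.mem_support_of_mem_edges {G : CapGraph V E} {u v : V} (p : Walk G u v) :
    ∀ e ∈ p.edges, ∀ x ∈ G.ends e, x ∈ p.support := by
  induction p with
  | nil u => simp [Walk.edges]
  | @cons u v w e h p ih =>
    intro e' he' x hx
    rcases List.mem_cons.1 he' with rfl | he'
    · rw [h, Sym2.mem_iff] at hx
      rcases hx with rfl | rfl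
      · simp [Walk.support]
      · simp [Walk.support, p.start_mem_support]
    · simp [Walk.support, ih e' he' x hx]

theorem Walk.edges_nodup {G : CapGraph V E} {u v : V} (p : Walk G u v) (hp : p.support.Nodup) :
    p.edges.Nodup := by
  induction p with
  | nil u => simp [Walk.edges]
  | @cons u v w e h p ih =>
    rw [Walk.support, List.nodup_cons] at hp
    refine List.nodup_cons.2 ⟨fun he => hp.1 ?_, ih hp.2⟩
    exact p.mem_support_of_mem_edges e he u (by simp [h])

open Classical in
/-- The demand between each two terminals generated by a weighted family of pairs of terminals. -/
noncomputable def pairWeight [Fintype Ω] (p : Ω → ℝ≥0) (a b : Ω → K) (z : Sym2 K) : ℝ≥0 :=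
  ∑ ω, if s(a ω, b ω) = z then p ω else 0

open Classical in
-- Reducing each walk to a path only removes edges, so sending `p ω` along these paths respects the
-- capacities.
theorem congestion_le_one [Fintype Ω] (H : CapGraph V E) (σ : K → V) (p : Ω → ℝ≥0) (a b : Ω → K)
    (U : Ω → Set E) (hU : ∀ ω, H.Joins (σ (a ω)) (σ (b ω)) (U ω))
    (hcap : ∀ e, ∑ ω, (if e ∈ U ω then p ω else 0) ≤ H.cap e) (D : Demand K)
    (hD : ∀ t t', t ≠ t' → D.val s(t, t') = pairWeight p a b s(t, t')) :
    H.congestion σ D ≤ 1 := by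
  choose P hP using fun ω => (hU ω).exists_path
  let R : Ω → TerminalPath H σ := fun ω => ⟨a ω, b ω, P ω⟩
  let f : Flow H σ := fun Q => ∑ ω, if Q = R ω then p ω else 0
  have key : ∀ t t', (∑' Q : Path H (σ t) (σ t'), (f ⟨t, t', Q⟩ : ℝ≥0∞))
      = ∑ ω, if a ω = t ∧ b ω = t' then (p ω : ℝ≥0∞) else 0 := by
    intro t t'
    simp only [f, ENNReal.ofNNReal_finsetSum]
    rw [Summable.tsum_finsetSum (fun _ _ => ENNReal.summable)]
    refine Finset.sum_congr rfl fun ω _ => ?_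
    split_ifs with h
    · obtain ⟨rfl, rfl⟩ := h
      rw [tsum_eq_single (P ω)]
      · simp [R]
      · intro Q hQ
        have : (⟨a ω, b ω, Q⟩ : TerminalPath H σ) ≠ R ω := fun h => hQ (by simpa [R] using h)
        simp [this]
    · refine ENNReal.tsum_eq_zero.2 fun Q => ?_
      have : (⟨t, t', Q⟩ : TerminalPath H σ) ≠ R ω := fun h' => h ⟨by
        simpa [R] using (congrArg TerminalPath.src h').symm, by
        simpa [R] using (congrArg TerminalPath.tgt h').symm⟩
      simp [this]
  have hroutes : f.Routes D := by
    intro t t' htt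
    rw [key, key, hD t t' htt, pairWeight, ENNReal.ofNNReal_finsetSum, ← Finset.sum_add_distrib]
    refine Finset.sum_congr rfl fun ω _ => ?_
    by_cases h1 : a ω = t ∧ b ω = t'
    · have : ¬ (a ω = t' ∧ b ω = t) := fun h => htt (h1.1 ▸ h.1)
      simp [h1, htt]
    · by_cases h2 : a ω = t' ∧ b ω = t
      · simp [h2, Sym2.eq_swap, htt.symm]
      · simp [h1, h2]
  refine (iInf₂_le f hroutes).trans (iSup_le fun e => ?_)
  refine ENNReal.div_le_of_le_mul ?_
  rw [one_mul]
  refine le_trans ?_ (ENNReal.coe_le_coe.2 (hcap e))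
  simp only [f, ENNReal.ofNNReal_finsetSum]
  rw [Summable.tsum_finsetSum (fun _ _ => ENNReal.summable)]
  refine Finset.sum_le_sum fun ω _ => ?_
  by_cases h : e ∈ (P ω).1.edges
  · rw [if_pos (hP ω e h), tsum_eq_single ⟨R ω, h⟩]
    · simp
    · rintro ⟨Q, hQ⟩ hne
      have : Q ≠ R ω := fun h' => hne (Subtype.ext h')
      simp [this]
  · refine le_of_eq_of_le (ENNReal.tsum_eq_zero.2 ?_) zero_le
    rintro ⟨Q, hQ⟩
    have : Q ≠ R ω := by rintro rfl; exact h hQ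
    simp [this]

/-- The equivalence between terminal paths and triples of two terminals and a path. -/
def terminalPathEquiv (G : CapGraph V E) (τ : K → V) :
    TerminalPath G τ ≃ Σ x : K × K, Path G (τ x.1) (τ x.2) where
  toFun Q := ⟨(Q.src, Q.tgt), Q.path⟩
  invFun Q := ⟨Q.1.1, Q.1.2, Q.2⟩
  left_inv _ := rfl
  right_inv _ := rfl

/-- Weak duality: each path is at least as long as the distance of its ends, and exchanging the sums
charges the flow to the edges, each of which carries at most congestion times capacity. -/
theorem tsum_flow_mul_dist_le [Fintype E] (G : CapGraph V E) (τ : K → V) (dist : K → K → ℝ≥0)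
    (len : E → ℝ≥0) (hd : ∀ t t' (P : Path G (τ t) (τ t')), dist t t' ≤ (P.1.edges.map len).sum)
    (f : Flow G τ) :
    ∑' Q : TerminalPath G τ, (f Q : ℝ≥0∞) * dist Q.src Q.tgt
      ≤ f.congestion * ∑ e, (G.cap e : ℝ≥0∞) * len e := by
  classical
  calc ∑' Q : TerminalPath G τ, (f Q : ℝ≥0∞) * dist Q.src Q.tgt
      ≤ ∑' Q : TerminalPath G τ, ∑ e, if e ∈ Q.path.1.edges then (f Q : ℝ≥0∞) * len e else 0 := by
        refine ENNReal.tsum_le_tsum fun Q => ?_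
        have h1 : (Q.path.1.edges.map len).sum = ∑ e, if e ∈ Q.path.1.edges then len e else 0 := by
          rw [← List.sum_toFinset _ (Q.path.1.edges_nodup Q.path.2), Finset.sum_ite,
            Finset.sum_const_zero, add_zero]
          congr 1
          ext e
          simp
        have h2 := hd _ _ Q.path
        rw [h1] at h2
        calc (f Q : ℝ≥0∞) * dist Q.src Q.tgt
            ≤ (f Q : ℝ≥0∞) * ((∑ e, if e ∈ Q.path.1.edges then len e else 0 : ℝ≥0) : ℝ≥0∞) := by
              gcongr
          _ = _ := by
              rw [ENNReal.ofNNReal_finsetSum, Finset.mul_sum]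
              refine Finset.sum_congr rfl fun e _ => ?_
              split_ifs <;> simp
    _ = ∑ e, (∑' Q : {Q : TerminalPath G τ // e ∈ Q.path.1.edges}, (f Q.1 : ℝ≥0∞)) * len e := by
        rw [Summable.tsum_finsetSum (fun _ _ => ENNReal.summable)]
        refine Finset.sum_congr rfl fun e _ => ?_
        rw [← ENNReal.tsum_mul_right]
        refine Eq.trans (tsum_congr fun Q => ?_) (tsum_subtype
          {Q : TerminalPath G τ | e ∈ Q.path.1.edges} (fun Q => (f Q : ℝ≥0∞) * len e)).symm
        simp [Set.indicator_apply]
    _ ≤ ∑ e, f.congestion * ((G.cap e : ℝ≥0∞) * len e) := by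
        refine Finset.sum_le_sum fun e _ => ?_
        rw [← mul_assoc]
        gcongr
        have : (∑' Q : {Q : TerminalPath G τ // e ∈ Q.path.1.edges}, (f Q.1 : ℝ≥0∞))
            / (G.cap e : ℝ≥0∞) ≤ f.congestion := le_iSup (fun e : E =>
          (∑' P : {P : TerminalPath G τ // e ∈ P.path.1.edges}, (f P.1 : ℝ≥0∞))
            / (G.cap e : ℝ≥0∞)) e
        rwa [ENNReal.div_le_iff (by simpa using (G.cap_pos e).ne') (by simp)] at this
    _ = _ := by rw [Finset.mul_sum]

theorem sum_mul_dist_le_congestion_mul [Fintype Ω] [Fintype E] [Fintype K] (G : CapGraph V E)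
    (τ : K → V) (dist : K → K → ℝ≥0) (hsymm : ∀ t t', dist t t' = dist t' t) (len : E → ℝ≥0)
    (hd : ∀ t t' (P : Path G (τ t) (τ t')), dist t t' ≤ (P.1.edges.map len).sum)
    (p : Ω → ℝ≥0) (a b : Ω → K) (D : Demand K)
    (hD : ∀ t t', t ≠ t' → D.val s(t, t') = pairWeight p a b s(t, t'))
    (f : Flow G τ) (hf : f.Routes D) :
    ∑ ω, (p ω : ℝ≥0∞) * dist (a ω) (b ω)
      ≤ f.congestion * ∑ e, (G.cap e : ℝ≥0∞) * len e := by
  classical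
  have hself : ∀ t, dist t t = 0 := fun t => by
    have := hd t t ⟨.nil (τ t), by simp [Walk.support]⟩
    simpa [Walk.edges] using this
  refine le_trans ?_ (tsum_flow_mul_dist_le G τ dist len hd f)
  let Φ : K × K → ℝ≥0∞ := fun x => ∑' P : Path G (τ x.1) (τ x.2), (f ⟨x.1, x.2, P⟩ : ℝ≥0∞)
  have h1 : ∑' Q : TerminalPath G τ, (f Q : ℝ≥0∞) * dist Q.src Q.tgt
      = ∑ x : K × K, Φ x * dist x.1 x.2 := by
    rw [← (terminalPathEquiv G τ).symm.tsum_eq, ENNReal.tsum_sigma', tsum_fintype]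
    refine Finset.sum_congr rfl fun x _ => ?_
    rw [← ENNReal.tsum_mul_right]
    rfl
  have h2 : ∑ x : K × K, Φ x * dist x.1 x.2 = ∑ x : K × K, Φ x.swap * dist x.1 x.2 := by
    rw [← (Equiv.prodComm K K).sum_comp]
    refine Finset.sum_congr rfl fun x _ => ?_
    simp [hsymm x.2 x.1]
  have h3 : ∀ x : K × K, (Φ x + Φ x.swap) * dist x.1 x.2
      = (pairWeight p a b s(x.1, x.2) : ℝ≥0∞) * dist x.1 x.2 := by
    intro x
    by_cases hx : x.1 = x.2
    · simp [hx, hself]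
    · rw [← hD _ _ hx, ← hf _ _ hx]
      rfl
  -- Routing only fixes the sum of the flows in the two orientations of a pair, so the sum is
  -- symmetrised; each pair of distinct terminals then occurs twice.
  have h4 : 2 * ∑ ω, (p ω : ℝ≥0∞) * dist (a ω) (b ω)
      ≤ 2 * ∑ x : K × K, Φ x * dist x.1 x.2 := by
    rw [two_mul (∑ x : K × K, _)]
    nth_rw 2 [h2]
    rw [← Finset.sum_add_distrib]
    simp_rw [← add_mul, h3, pairWeight, ENNReal.ofNNReal_finsetSum, Finset.sum_mul]
    rw [Finset.sum_comm, Finset.mul_sum]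
    refine Finset.sum_le_sum fun ω _ => ?_
    by_cases hab : a ω = b ω
    · simp [hab, hself]
    · have hne : (a ω, b ω) ≠ (b ω, a ω) := fun h => hab (congrArg Prod.fst h)
      refine le_trans (le_of_eq ?_) (Finset.sum_le_sum_of_subset
        (Finset.subset_univ {(a ω, b ω), (b ω, a ω)}))
      rw [Finset.sum_pair hne]
      simp [Sym2.eq_swap, hsymm (b ω) (a ω), two_mul]
  rw [h1]
  exact (ENNReal.mul_le_mul_iff_right (by simp) (by simp)).1 h4

/-- A flow sparsifier carries no family of walks between terminals whose total `dist`-length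
exceeds `q` times the volume of `G`. -/
theorem sum_mul_dist_le_of_isFlowSparsifier {V' E' : Type} [Fintype Ω] [Fintype E] [Fintype K]
    (G : CapGraph V E) (τ : K → V) (dist : K → K → ℝ≥0) (hsymm : ∀ t t', dist t t' = dist t' t)
    (len : E → ℝ≥0)
    (hd : ∀ t t' (P : Path G (τ t) (τ t')), dist t t' ≤ (P.1.edges.map len).sum)
    (H : CapGraph V' E') (σ : K → V') (p : Ω → ℝ≥0) (a b : Ω → K)
    (U : Ω → Set E') (hU : ∀ ω, H.Joins (σ (a ω)) (σ (b ω)) (U ω))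
    (hcap : ∀ e, open Classical in ∑ ω, (if e ∈ U ω then p ω else 0) ≤ H.cap e) (q : ℝ)
    (hq : G.IsFlowSparsifier τ H σ q) :
    ∑ ω, (p ω : ℝ) * dist (a ω) (b ω) ≤ q * ∑ e, (G.cap e : ℝ) * len e := by
  classical
  have hself : ∀ t, dist t t = 0 := fun t => by
    have := hd t t ⟨.nil (τ t), by simp [Walk.support]⟩
    simpa [Walk.edges] using this
  have hq0 : 0 ≤ q := zero_le_one.trans hq.1
  -- A demand may not vanish identically, so families without weight between distinct terminals are
  -- treated apart.
  by_cases hex : ∃ ω, a ω ≠ b ω ∧ p ω ≠ 0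
  swap
  · refine le_of_eq_of_le (Finset.sum_eq_zero fun ω _ => ?_) (by positivity)
    by_cases hab : a ω = b ω
    · simp [hab, hself]
    · have : p ω = 0 := by_contra fun h => hex ⟨ω, hab, h⟩
      simp [this]
  obtain ⟨ω₀, hab, hp⟩ := hex
  let D : Demand K :=
    { val := fun z => if z.IsDiag then 0 else pairWeight p a b z
      val_diag := fun t => by simp
      exists_ne_zero := ⟨s(a ω₀, b ω₀), by
        rw [if_neg (by simpa using hab)]
        refine (lt_of_lt_of_le (pos_iff_ne_zero.2 hp) ?_).ne'
        refine le_trans ?_ (Finset.single_le_sum (fun _ _ => zero_le) (Finset.mem_univ ω₀))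
        simp⟩ }
  have hD : ∀ t t', t ≠ t' → D.val s(t, t') = pairWeight p a b s(t, t') := fun t t' h => by
    simp [D, h]
  have hG : G.congestion τ D ≤ ENNReal.ofReal q := by
    refine (hq.2 D).2.trans ?_
    calc ENNReal.ofReal q * H.congestion σ D ≤ ENNReal.ofReal q * 1 := by
          gcongr
          exact congestion_le_one H σ p a b U hU hcap D hD
      _ = _ := mul_one _
  set A : ℝ := ∑ e, (G.cap e : ℝ) * len e with hA
  have hA' : ∑ e, (G.cap e : ℝ≥0∞) * len e = ENNReal.ofReal A := by
    rw [hA, ENNReal.ofReal_sum_of_nonneg (fun _ _ => by positivity)]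
    refine Finset.sum_congr rfl fun e _ => ?_
    rw [ENNReal.ofReal_mul (by positivity), ENNReal.ofReal_coe_nnreal, ENNReal.ofReal_coe_nnreal]
  have hX : ∑ ω, (p ω : ℝ≥0∞) * dist (a ω) (b ω)
      = ENNReal.ofReal (∑ ω, (p ω : ℝ) * dist (a ω) (b ω)) := by
    rw [ENNReal.ofReal_sum_of_nonneg (fun _ _ => by positivity)]
    refine Finset.sum_congr rfl fun e _ => ?_
    rw [ENNReal.ofReal_mul (by positivity), ENNReal.ofReal_coe_nnreal, ENNReal.ofReal_coe_nnreal]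
  have hA0 : 0 ≤ A := Finset.sum_nonneg fun _ _ => by positivity
  -- The congestion is an infimum: a flow of congestion below `q + δ` is used, and `δ` is arbitrary.
  have key : ∀ δ : ℝ, 0 < δ → ∑ ω, (p ω : ℝ) * dist (a ω) (b ω) ≤ (q + δ) * A := by
    intro δ hδ
    have hlt : G.congestion τ D < ENNReal.ofReal (q + δ) :=
      hG.trans_lt ((ENNReal.ofReal_lt_ofReal_iff (by linarith)).2 (by linarith))
    simp only [congestion, iInf_lt_iff] at hlt
    obtain ⟨f, hf, hlt⟩ := hlt
    have h1 := sum_mul_dist_le_congestion_mul G τ dist hsymm len hd p a b D hD f hf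
    rw [hX, hA'] at h1
    have h2 := h1.trans (mul_le_mul_left hlt.le _)
    rw [← ENNReal.ofReal_mul (by positivity)] at h2
    exact (ENNReal.ofReal_le_ofReal_iff (by positivity)).1 h2
  refine le_of_forall_pos_le_add fun δ hδ => ?_
  have h1 := key (δ / (A + 1)) (by positivity)
  have h2 : δ / (A + 1) * A ≤ δ := by
    rw [div_mul_eq_mul_div, div_le_iff₀ (by positivity)]
    nlinarith
  linarith

theorem Joins.glue {ι : Type} {W F : ι → Type} (H : ∀ i, CapGraph (W i) (F i))
    (τ : ∀ i, K → W i) (p : ι → ℝ≥0) (hp : ∀ i, 0 < p i) (i : ι) {u v : W i} {A : Set (F i)}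
    (h : (H i).Joins u v A) :
    (CapGraph.glue H τ p hp).Joins (Quot.mk _ (Sum.inr ⟨i, u⟩)) (Quot.mk _ (Sum.inr ⟨i, v⟩))
      {e | ∃ e' ∈ A, e = ⟨i, e'⟩} := by
  obtain ⟨w, hw⟩ := h
  induction w with
  | nil u => exact (Joins.refl _ _).mono (Set.empty_subset _)
  | @cons u v w e he q ih =>
    refine (Joins.trans (Joins.of_edge (e := (⟨i, e⟩ : Σ i, F i)) (v := Quot.mk _ (Sum.inr ⟨i, v⟩))
      ?_) (ih fun e' h' => hw e' (by simp [Walk.edges, h']))).mono ?_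
    · simp [CapGraph.glue, he]
    · refine Set.union_subset ?_ subset_rfl
      rintro _ rfl
      exact ⟨e, hw e (by simp [Walk.edges]), rfl⟩

/-- `H` carries, within its capacities, a family of walks between terminals of total
`dist`-length at least `X`. -/
def CarriesLength {V' E' : Type} (H : CapGraph V' E') (σ : K → V') (dist : K → K → ℝ≥0)
    (X : ℝ) : Prop :=
  ∃ (Ω : Type) (_ : Fintype Ω) (p : Ω → ℝ≥0) (a b : Ω → K) (U : Ω → Set E'),
    (∀ ω, H.Joins (σ (a ω)) (σ (b ω)) (U ω)) ∧
    (∀ e, open Classical in ∑ ω, (if e ∈ U ω then p ω else 0) ≤ H.cap e) ∧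
    X ≤ ∑ ω, (p ω : ℝ) * dist (a ω) (b ω)

/-- The union of the families of the copies, scaled by `p i`, respects the scaled capacities, and
its length is an average of lengths that are at least `X`. -/
theorem CarriesLength.glue {ι : Type} [Fintype ι] {W F : ι → Type} (H : ∀ i, CapGraph (W i) (F i))
    (τ : ∀ i, K → W i) (p : ι → ℝ≥0) (hp : ∀ i, 0 < p i) (hsum : ∑ i, p i = 1)
    (dist : K → K → ℝ≥0) (X : ℝ) (h : ∀ i, (H i).CarriesLength (τ i) dist X) :
    (CapGraph.glue H τ p hp).CarriesLength (fun t => Quot.mk _ (Sum.inl t)) dist X := by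
  classical
  choose Ω hΩ w a b U hU hcap hX using h
  refine ⟨Σ i, Ω i, inferInstance, fun ω => p ω.1 * w ω.1 ω.2, fun ω => a ω.1 ω.2,
    fun ω => b ω.1 ω.2, fun ω => {e | ∃ e' ∈ U ω.1 ω.2, e = ⟨ω.1, e'⟩}, fun ω => ?_, ?_, ?_⟩
  · have h1 := Joins.glue H τ p hp ω.1 (hU ω.1 ω.2)
    rwa [← Quot.sound (GlueRel.terminal (τ := τ) (a ω.1 ω.2) ω.1),
      ← Quot.sound (GlueRel.terminal (τ := τ) (b ω.1 ω.2) ω.1)] at h1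
  · rintro ⟨i, e⟩
    rw [Fintype.sum_sigma, Finset.sum_eq_single i]
    · refine le_trans (le_of_eq ?_) (mul_le_mul_right (hcap i e) (p i))
      rw [Finset.mul_sum]
      refine Finset.sum_congr rfl fun ω _ => ?_
      by_cases he : e ∈ U i ω
      · simp [he]
      · simp [he]
    · intro j _ hj
      refine Finset.sum_eq_zero fun ω _ => if_neg ?_
      rintro ⟨e', -, h⟩
      exact hj (congrArg Sigma.fst h).symm
    · simp
  · rw [Fintype.sum_sigma]
    calc X = ∑ i, (p i : ℝ) * X := by
          rw [← Finset.sum_mul, ← NNReal.coe_sum, hsum]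
          simp
      _ ≤ _ := by
          refine Finset.sum_le_sum fun i _ => ?_
          refine (mul_le_mul_of_nonneg_left (hX i) (p i).2).trans (le_of_eq ?_)
          rw [Finset.mul_sum]
          refine Finset.sum_congr rfl fun ω _ => ?_
          exact ((congrArg (· * _) (NNReal.coe_mul _ _)).trans (mul_assoc _ _ _)).symm

theorem CarriesLength.le_of_isFlowSparsifier {V' E' : Type} [Fintype E] [Fintype K]
    {G : CapGraph V E} {τ : K → V} {dist : K → K → ℝ≥0} (hsymm : ∀ t t', dist t t' = dist t' t)
    {len : E → ℝ≥0}
    (hd : ∀ t t' (P : Path G (τ t) (τ t')), dist t t' ≤ (P.1.edges.map len).sum)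
    {H : CapGraph V' E'} {σ : K → V'} {X : ℝ} (hX : H.CarriesLength σ dist X) {q : ℝ}
    (hq : G.IsFlowSparsifier τ H σ q) : X ≤ q * ∑ e, (G.cap e : ℝ) * len e := by
  obtain ⟨Ω, _, p, a, b, U, hU, hcap, hX⟩ := hX
  exact hX.trans (sum_mul_dist_le_of_isFlowSparsifier G τ dist hsymm len hd H σ p a b U hU hcap q hq)

end CapGraph

/-! ### Reduced words and truncated word distance in groups of large girth. -/

section Words

variable {α V : Type} [DecidableEq α] [Group V]

/-- The inverse of a letter of the free group. -/
def invLetter (l : α × Bool) : α × Bool := (l.1, !l.2)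

@[simp] theorem invLetter_invLetter (l : α × Bool) : invLetter (invLetter l) = l := by
  simp [invLetter]

theorem mk_invLetter (l : α × Bool) :
    (FreeGroup.mk [invLetter l] : FreeGroup α) = (FreeGroup.mk [l])⁻¹ := by
  simp [invLetter, FreeGroup.inv_mk, FreeGroup.invRev]

theorem toWord_mul_of_not_cancel (z u : FreeGroup α)
    (h : ∀ a ∈ z.toWord.getLast?, ∀ b ∈ u.toWord.head?, b ≠ invLetter a) :
    (z * u).toWord = z.toWord ++ u.toWord := by
  rw [FreeGroup.toWord_mul]
  refine FreeGroup.IsReduced.reduce_eq ?_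
  refine List.isChain_append.2 ⟨FreeGroup.isReduced_toWord, FreeGroup.isReduced_toWord, ?_⟩
  rintro ⟨a, b⟩ ha ⟨c, d⟩ hb (rfl : a = c)
  have := h _ ha _ hb
  simp only [invLetter, ne_eq, Prod.mk.injEq, true_and] at this
  cases b <;> cases d <;> simp_all

theorem head?_toWord_inv (u : FreeGroup α) :
    u⁻¹.toWord.head? = u.toWord.getLast?.map invLetter := by
  rw [FreeGroup.toWord_inv, FreeGroup.invRev, List.head?_reverse, List.getLast?_map]
  rfl

theorem toWord_mk_singleton (l : α × Bool) : (FreeGroup.mk [l] : FreeGroup α).toWord = [l] := by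
  rw [FreeGroup.toWord_mk, FreeGroup.reduce_singleton]

/-- The vertex reached from `x` along the letter `l` in the Cayley graph of `s`. -/
def letterStep (s : α → V) (x : V) (l : α × Bool) : V :=
  x * FreeGroup.lift s (FreeGroup.mk [l])

@[simp] theorem letterStep_inv (s : α → V) (x : V) (l : α × Bool) :
    letterStep s (letterStep s x l) (invLetter l) = x := by
  simp only [letterStep, mk_invLetter, map_inv, mul_inv_cancel_right]

/-- No nontrivial word of length at most `g` in the elements `s` is a relation. -/
def GirthAtLeast (s : α → V) (g : ℕ) : Prop :=
  ∀ z : FreeGroup α, z.norm ≤ g → FreeGroup.lift s z = 1 → z = 1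

/-- The girth enters in this form: short words are determined by their values, so balls are trees.
-/
theorem GirthAtLeast.eq {s : α → V} {g : ℕ} (hs : GirthAtLeast s g) {z z' : FreeGroup α}
    (hn : z.norm + z'.norm ≤ g) (h : FreeGroup.lift s z = FreeGroup.lift s z') : z = z' := by
  refine mul_inv_eq_one.1 (hs (z * z'⁻¹) ?_ ?_)
  · exact (FreeGroup.norm_mul_le _ _).trans (by rwa [FreeGroup.norm_inv_eq])
  · simp [h]

/-- The word distance of the Cayley graph of `s`, truncated at `R`. -/
noncomputable def wordDist (s : α → V) (R : ℕ) (x y : V) : ℕ :=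
  sInf (insert R {n | ∃ z : FreeGroup α, z.norm = n ∧ x * FreeGroup.lift s z = y})

/-- The truncation keeps the distance finite, since `s` need not generate the group. -/
theorem wordDist_le (s : α → V) (R : ℕ) (x y : V) : wordDist s R x y ≤ R :=
  Nat.sInf_le (Set.mem_insert _ _)

theorem wordDist_le_norm {s : α → V} {R : ℕ} {x y : V} (z : FreeGroup α)
    (h : x * FreeGroup.lift s z = y) : wordDist s R x y ≤ z.norm :=
  Nat.sInf_le (Set.mem_insert_of_mem _ ⟨z, rfl, h⟩)

theorem exists_of_wordDist_lt {s : α → V} {R : ℕ} {x y : V} (h : wordDist s R x y < R) :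
    ∃ z : FreeGroup α, z.norm = wordDist s R x y ∧ x * FreeGroup.lift s z = y := by
  have := Nat.sInf_mem (s := insert R {n | ∃ z : FreeGroup α, z.norm = n ∧
    x * FreeGroup.lift s z = y}) ⟨R, Set.mem_insert _ _⟩
  exact this.resolve_left h.ne

@[simp] theorem wordDist_self (s : α → V) (R : ℕ) (x : V) : wordDist s R x x = 0 := by
  simpa using wordDist_le_norm (s := s) (R := R) (x := x) (y := x) 1 (by simp)

theorem wordDist_comm (s : α → V) (R : ℕ) (x y : V) : wordDist s R x y = wordDist s R y x := by
  have key : ∀ x y : V, wordDist s R x y ≤ wordDist s R y x := fun x y => by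
    rcases (wordDist_le s R y x).lt_or_eq with h | h
    · obtain ⟨z, hz, hy⟩ := exists_of_wordDist_lt h
      rw [← hz, ← FreeGroup.norm_inv_eq]
      exact wordDist_le_norm _ (by rw [← hy]; simp)
    · rw [h]
      exact wordDist_le s R x y
  exact (key x y).antisymm (key y x)

theorem wordDist_triangle (s : α → V) (R : ℕ) (x y z : V) :
    wordDist s R x z ≤ wordDist s R x y + wordDist s R y z := by
  rcases (wordDist_le s R x y).lt_or_eq with h | h
  · rcases (wordDist_le s R y z).lt_or_eq with h' | h'
    · obtain ⟨u, hu, rfl⟩ := exists_of_wordDist_lt h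
      obtain ⟨v, hv, rfl⟩ := exists_of_wordDist_lt h'
      rw [← hu, ← hv]
      exact (wordDist_le_norm (u * v) (by simp [mul_assoc])).trans (FreeGroup.norm_mul_le _ _)
    · have := wordDist_le s R x z
      omega
  · have := wordDist_le s R x z
    omega

theorem norm_mk_singleton (l : α × Bool) : (FreeGroup.mk [l] : FreeGroup α).norm = 1 := by
  simp [FreeGroup.norm]

theorem wordDist_letterStep_le (s : α → V) (R : ℕ) (x : V) (l : α × Bool) :
    wordDist s R x (letterStep s x l) ≤ 1 :=
  (wordDist_le_norm (FreeGroup.mk [l]) rfl).trans (norm_mk_singleton l).le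

theorem wordDist_eq_norm {s : α → V} {g R : ℕ} (hs : GirthAtLeast s g) (hR : 2 * R ≤ g) {x y : V}
    (z : FreeGroup α) (hz : z.norm ≤ R) (h : x * FreeGroup.lift s z = y) :
    wordDist s R x y = z.norm := by
  refine (wordDist_le_norm z h).antisymm ?_
  by_contra! hlt
  obtain ⟨u, hu, hy⟩ := exists_of_wordDist_lt (hlt.trans_le hz)
  have := hs.eq (z := z) (z' := u) (by omega) (mul_left_cancel (h.trans hy.symm))
  subst this
  omega

theorem card_wordDist_le [Fintype α] [Fintype V] (s : α → V) (R ρ : ℕ) (hρ : ρ < R) (x : V) :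
    (Finset.univ.filter fun y => wordDist s R x y ≤ ρ).card ≤ (2 * Fintype.card α + 1) ^ ρ := by
  classical
  have key : ∀ n : ℕ, ∃ B : Finset V, B.card ≤ (2 * Fintype.card α + 1) ^ n ∧
      ∀ z : FreeGroup α, z.norm ≤ n → FreeGroup.lift s z ∈ B := by
    intro n
    induction n with
    | zero =>
      refine ⟨{1}, by simp, fun z hz => ?_⟩
      have : z = 1 := by simpa using hz
      simp [this]
    | succ n ih =>
      obtain ⟨B, hB, hmem⟩ := ih
      -- A word of length at most `n + 1` is empty (`none`) or a letter followed by a word of length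
      -- at most `n`.
      refine ⟨(B ×ˢ (Finset.univ : Finset (Option (α × Bool)))).image fun q =>
        (q.2.elim 1 fun l => FreeGroup.lift s (FreeGroup.mk [l])) * q.1, ?_, fun z hz => ?_⟩
      · refine Finset.card_image_le.trans ?_
        rw [Finset.card_product, pow_succ]
        refine Nat.mul_le_mul hB ?_
        simp [mul_comm]
      · rw [Finset.mem_image]
        rcases hw : z.toWord with _ | ⟨l, w⟩
        · obtain rfl : z = 1 := FreeGroup.toWord_eq_nil_iff.1 hw
          exact ⟨(1, none), by simpa using hmem 1 (by simp), by simp⟩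
        · refine ⟨(FreeGroup.lift s (FreeGroup.mk w), some l), ?_, ?_⟩
          · simp only [Finset.mem_product, Finset.mem_univ, and_true]
            refine hmem _ (FreeGroup.norm_mk_le.trans ?_)
            have : z.norm = w.length + 1 := by simp [FreeGroup.norm, hw]
            omega
          · have : z = FreeGroup.mk [l] * FreeGroup.mk w := by
              rw [FreeGroup.mul_mk, ← FreeGroup.mk_toWord (x := z), hw]
              rfl
            simp only [this, map_mul, Option.elim_some]
  obtain ⟨B, hB, hmem⟩ := key ρ
  refine le_trans (Finset.card_le_card (t := B.image fun v => x * v) fun y hy => ?_)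
    (Finset.card_image_le.trans hB)
  have hy : wordDist s R x y ≤ ρ := by simpa using hy
  obtain ⟨z, hz, rfl⟩ := exists_of_wordDist_lt (hy.trans_lt hρ)
  exact Finset.mem_image_of_mem _ (hmem z (hz.trans_le hy))

end Words

/-! ### Directions in which a class is seen from its own vertices. -/

section Directions

variable {α V κ : Type} [DecidableEq α] [Group V]

/-- Some vertex of `V₁` in the class of `x` lies in the direction `l` from `x`, at distance at most
`D`. -/
def Occupied (s : α → V) (cl : V → κ) (V₁ : Finset V) (D : ℕ) (x : V) (l : α × Bool) : Prop :=
  ∃ u : FreeGroup α, u.norm ≤ D ∧ x * FreeGroup.lift s u ∈ V₁ ∧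
    cl (x * FreeGroup.lift s u) = cl x ∧ u.toWord.head? = some l

/-- Place `x` at the node `ζ x` of the tree rooted at the centre of its class. A step in direction
`l` either goes back towards the root or extends the word of `x` by `l`; in the second case,
uniqueness of words of total length `4 * ρ` makes the word of the vertex reached continue from
there. -/
theorem Occupied.cases {s : α → V} {cl : V → κ} {V₁ : Finset V} {ρ g : ℕ} (hs : GirthAtLeast s g)
    (hg : 4 * ρ ≤ g) {ctr : κ → V} {ζ : V → FreeGroup α} (hζ : ∀ x ∈ V₁, (ζ x).norm ≤ ρ)
    (hctr : ∀ x ∈ V₁, ctr (cl x) * FreeGroup.lift s (ζ x) = x) {x : V} (hx : x ∈ V₁)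
    {l : α × Bool} (h : Occupied s cl V₁ (2 * ρ) x l) :
    (ζ x).toWord.getLast? = some (invLetter l) ∨
      ∃ y ∈ V₁, cl y = cl x ∧ (ζ x).toWord ++ [l] <+: (ζ y).toWord := by
  obtain ⟨u, hu, hy, hcl, hl⟩ := h
  by_cases hlast : (ζ x).toWord.getLast? = some (invLetter l)
  · exact Or.inl hlast
  refine Or.inr ⟨_, hy, hcl, ?_⟩
  have h1 : ζ x * u = ζ (x * FreeGroup.lift s u) := by
    refine hs.eq ?_ ?_
    · have := FreeGroup.norm_mul_le (ζ x) u
      have := hζ _ hx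
      have := hζ _ hy
      omega
    · refine mul_left_cancel (a := ctr (cl x)) ?_
      have h2 := hctr _ hy
      rw [hcl] at h2
      rw [map_mul, ← mul_assoc, hctr x hx, h2]
  rw [← h1, toWord_mul_of_not_cancel]
  · rw [List.prefix_append_right_inj]
    obtain ⟨t, ht⟩ : ∃ t, u.toWord = l :: t := by
      cases hu' : u.toWord <;> simp_all
    rw [ht]
    exact ⟨t, rfl⟩
  · intro a ha b hb hab
    rw [Option.mem_def] at ha hb
    rw [hl] at hb
    cases hb
    exact hlast (by rw [ha, hab, invLetter_invLetter])

open Classical in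
-- At most one direction per vertex points to the root. A direction pointing away from it is
-- assigned to a shortest word of the class beyond it, and this assignment is injective.
theorem card_occupied_le [Fintype α] [Fintype V] {s : α → V} {cl : V → κ} {V₁ : Finset V}
    {ρ g : ℕ} (hs : GirthAtLeast s g) (hg : 4 * ρ ≤ g) {ctr : κ → V} {ζ : V → FreeGroup α}
    (hζ : ∀ x ∈ V₁, (ζ x).norm ≤ ρ)
    (hctr : ∀ x ∈ V₁, ctr (cl x) * FreeGroup.lift s (ζ x) = x) :
    (Finset.univ.filter fun e : V × (α × Bool) =>
      e.1 ∈ V₁ ∧ Occupied s cl V₁ (2 * ρ) e.1 e.2).card ≤ 2 * V₁.card := by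
  let A : Finset (V × (α × Bool)) := Finset.univ.filter fun e =>
    e.1 ∈ V₁ ∧ (ζ e.1).toWord.getLast? = some (invLetter e.2)
  let B : Finset (V × (α × Bool)) := Finset.univ.filter fun e =>
    e.1 ∈ V₁ ∧ ∃ y ∈ V₁, cl y = cl e.1 ∧ (ζ e.1).toWord ++ [e.2] <+: (ζ y).toWord
  have hA : A.card ≤ V₁.card := by
    refine Finset.card_le_card_of_injOn Prod.fst (fun e he => (Finset.mem_filter.1 he).2.1) ?_
    rintro ⟨x, l⟩ h1 ⟨y, l'⟩ h2 (rfl : x = y)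
    have h1 := (Finset.mem_filter.1 h1).2.2
    have h2 := (Finset.mem_filter.1 h2).2.2
    rw [h1, Option.some_inj] at h2
    rw [← invLetter_invLetter l, h2, invLetter_invLetter]
  have hB : B.card ≤ V₁.card := by
    have hmin : ∀ e : V × (α × Bool), e ∈ B → ∃ y ∈ V₁, cl y = cl e.1 ∧
        (ζ e.1).toWord ++ [e.2] <+: (ζ y).toWord ∧ ∀ y' ∈ V₁, cl y' = cl e.1 →
        (ζ e.1).toWord ++ [e.2] <+: (ζ y').toWord →
        (ζ y).toWord.length ≤ (ζ y').toWord.length := by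
      intro e he
      obtain ⟨y, hy⟩ := (Finset.mem_filter.1 he).2.2
      obtain ⟨y, hy, hle⟩ := Finset.exists_min_image
        (V₁.filter fun y => cl y = cl e.1 ∧ (ζ e.1).toWord ++ [e.2] <+: (ζ y).toWord)
        (fun y => (ζ y).toWord.length) ⟨y, by simpa using hy⟩
      obtain ⟨h1, h2, h3⟩ := Finset.mem_filter.1 hy
      exact ⟨y, h1, h2, h3, fun y' h1' h2' h3' => hle y' (by simp [h1', h2', h3'])⟩
    choose! m hm1 hm2 hm3 hm4 using hmin
    -- Were `e'` deeper than `e`, its tail would itself be a vertex of the class beyond `e`, closer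
    -- than the common shortest one.
    have hlen : ∀ e ∈ B, ∀ e' ∈ B, m e = m e' →
        (ζ e'.1).toWord.length ≤ (ζ e.1).toWord.length := by
      intro e he e' he' hee
      by_contra! hlt
      have hmem' : e'.1 ∈ V₁ := (Finset.mem_filter.1 he').2.1
      have hcl : cl e'.1 = cl e.1 := by rw [← hm2 e' he', ← hee, hm2 e he]
      have h1 : (ζ e.1).toWord ++ [e.2] <+: (ζ e'.1).toWord := by
        refine List.prefix_of_prefix_length_le (hm3 e he) ?_ (by simp; omega)
        rw [hee]
        exact (List.prefix_append _ _).trans (hm3 e' he')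
      have h2 := hm4 e he e'.1 hmem' hcl h1
      have h3 := (hm3 e' he').length_le
      rw [← hee] at h3
      simp only [List.length_append, List.length_singleton] at h3
      omega
    refine Finset.card_le_card_of_injOn m (fun e he => hm1 e he) fun e he e' he' hee => ?_
    have hl := (hlen e' he' e he hee.symm).antisymm (hlen e he e' he' hee)
    have h1 := hm3 e he
    rw [hee] at h1
    have h2 := (List.prefix_of_prefix_length_le h1 (hm3 e' he') (by simp [hl])).eq_of_length
      (by simp [hl])
    obtain ⟨hw, hl⟩ := List.append_inj' h2 rfl
    have hcl : cl e.1 = cl e'.1 := by rw [← hm2 e he, hee, hm2 e' he']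
    refine Prod.ext ?_ (by simpa using hl)
    rw [← hctr e.1 (Finset.mem_filter.1 he).2.1, ← hctr e'.1 (Finset.mem_filter.1 he').2.1, hcl,
      FreeGroup.toWord_injective hw]
  calc _ ≤ (A ∪ B).card := Finset.card_le_card fun e he => by
          obtain ⟨h1, h2⟩ := (Finset.mem_filter.1 he).2
          rcases h2.cases hs hg hζ hctr h1 with h | h
          · exact Finset.mem_union_left _ (by simp [A, h1, h])
          · exact Finset.mem_union_right _ (by simp only [B, Finset.mem_filter]; simpa [h1] using h)
    _ ≤ A.card + B.card := Finset.card_union_le _ _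
    _ ≤ 2 * V₁.card := by omega

/-- The directed edge `e` traversed backwards. -/
def revEdge (s : α → V) (e : V × (α × Bool)) : V × (α × Bool) :=
  (letterStep s e.1 e.2, invLetter e.2)

theorem revEdge_involutive (s : α → V) : Function.Involutive (revEdge s) := by
  rintro ⟨x, l⟩
  simp [revEdge]

open Classical in
/-- The directed edges within `V₁` none of whose ends has its class in the direction of the
edge. -/
noncomputable def goodEdges [Fintype α] [Fintype V] (s : α → V) (cl : V → κ) (V₁ : Finset V)
    (D : ℕ) : Finset (V × (α × Bool)) :=
  Finset.univ.filter fun e => (e.1 ∈ V₁ ∧ ¬ Occupied s cl V₁ D e.1 e.2) ∧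
    (letterStep s e.1 e.2 ∈ V₁ ∧
      ¬ Occupied s cl V₁ D (letterStep s e.1 e.2) (invLetter e.2))

theorem mem_goodEdges [Fintype α] [Fintype V] {s : α → V} {cl : V → κ} {V₁ : Finset V}
    {D : ℕ} {e : V × (α × Bool)} : e ∈ goodEdges s cl V₁ D ↔
      (e.1 ∈ V₁ ∧ ¬ Occupied s cl V₁ D e.1 e.2) ∧ (letterStep s e.1 e.2 ∈ V₁ ∧
        ¬ Occupied s cl V₁ D (letterStep s e.1 e.2) (invLetter e.2)) := by
  simp [goodEdges]

theorem revEdge_mem_goodEdges [Fintype α] [Fintype V] {s : α → V} {cl : V → κ} {V₁ : Finset V}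
    {D : ℕ} {e : V × (α × Bool)} (he : e ∈ goodEdges s cl V₁ D) :
    revEdge s e ∈ goodEdges s cl V₁ D := by
  simp only [mem_goodEdges, revEdge, letterStep_inv, invLetter_invLetter] at he ⊢
  exact ⟨he.2, he.1⟩

/-- Up to reversal, a bad edge is spoilt at its tail: the tail is one of the vertices outside `V₁`,
or the direction is occupied, which happens at most twice per vertex on average. Reversal doubles
both counts. -/
theorem le_card_goodEdges [Fintype α] [Fintype V] {s : α → V} {cl : V → κ}
    {V₁ : Finset V}
    {ρ g : ℕ} (hs : GirthAtLeast s g) (hg : 4 * ρ ≤ g) {ctr : κ → V} {ζ : V → FreeGroup α}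
    (hζ : ∀ x ∈ V₁, (ζ x).norm ≤ ρ)
    (hctr : ∀ x ∈ V₁, ctr (cl x) * FreeGroup.lift s (ζ x) = x) :
    2 * Fintype.card α * Fintype.card V ≤ (goodEdges s cl V₁ (2 * ρ)).card
      + 4 * Fintype.card α * (Fintype.card V - V₁.card) + 4 * Fintype.card V := by
  classical
  let P : Finset (V × (α × Bool)) := Finset.univ.filter fun e =>
    ¬ (e.1 ∈ V₁ ∧ ¬ Occupied s cl V₁ (2 * ρ) e.1 e.2)
  have hP : P.card ≤ 2 * Fintype.card α * V₁ᶜ.card + 2 * Fintype.card V := by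
    have h1 : P ⊆ (V₁ᶜ ×ˢ (Finset.univ : Finset (α × Bool))) ∪ Finset.univ.filter fun e =>
        e.1 ∈ V₁ ∧ Occupied s cl V₁ (2 * ρ) e.1 e.2 := by
      intro e he
      have := (Finset.mem_filter.1 he).2
      by_cases h : e.1 ∈ V₁
      · refine Finset.mem_union_right _ (Finset.mem_filter.2 ⟨Finset.mem_univ _, h, ?_⟩)
        by_contra h'
        exact this ⟨h, h'⟩
      · exact Finset.mem_union_left _ (by simp [h])
    refine (Finset.card_le_card h1).trans ((Finset.card_union_le _ _).trans ?_)
    have h2 := card_occupied_le hs hg hζ hctr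
    have h3 : V₁.card ≤ Fintype.card V := Finset.card_le_univ _
    rw [Finset.card_product]
    have h4 : (Finset.univ : Finset (α × Bool)).card = 2 * Fintype.card α := by
      simp [mul_comm]
    rw [h4, mul_comm]
    refine Nat.add_le_add_left (le_trans ?_ (Nat.mul_le_mul_left 2 h3)) _
    convert h2
  have hsub : (goodEdges s cl V₁ (2 * ρ))ᶜ ⊆ P ∪ P.image (revEdge s) := by
    intro e he
    simp only [goodEdges, Finset.mem_compl, Finset.mem_filter, Finset.mem_univ, true_and] at he
    rw [not_and_or] at he
    rcases he with he | he
    · exact Finset.mem_union_left _ (Finset.mem_filter.2 ⟨Finset.mem_univ _, he⟩)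
    · refine Finset.mem_union_right _ (Finset.mem_image.2 ⟨revEdge s e, ?_, revEdge_involutive s e⟩)
      exact Finset.mem_filter.2 ⟨Finset.mem_univ _, he⟩
  have h1 := (Finset.card_le_card hsub).trans (Finset.card_union_le _ _)
  have h2 : (P.image (revEdge s)).card ≤ P.card := Finset.card_image_le
  have h4 : (goodEdges s cl V₁ (2 * ρ)).card + (goodEdges s cl V₁ (2 * ρ))ᶜ.card
      = 2 * Fintype.card α * Fintype.card V := by
    rw [Finset.card_add_card_compl]
    simp only [Fintype.card_prod, Fintype.card_bool]
    ring
  rw [← Finset.card_compl]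
  have h3 : 4 * Fintype.card α * V₁ᶜ.card = 2 * (2 * Fintype.card α * V₁ᶜ.card) := by ring
  omega

end Directions

/-! ### Random chains of good edges and free jumps inside classes. -/

section Chain

/-- The undirected edge underlying a directed edge of the Cayley graph of `s`. -/
def edgeId {α V : Type} [DecidableEq α] [Group V] (s : α → V) (e : V × (α × Bool)) : V × α :=
  if e.2.2 then (e.1, e.2.1) else (letterStep s e.1 e.2, e.2.1)

theorem edgeId_eq {α V : Type} [DecidableEq α] [Group V] {s : α → V} {e : V × (α × Bool)} {b : V × α}
    (h : edgeId s e = b) : e = (b.1, (b.2, true)) ∨ e = revEdge s (b.1, (b.2, true)) := by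
  obtain ⟨x, a, c⟩ := e
  subst h
  cases c
  · right
    refine ((revEdge_involutive s) _).symm.trans (congrArg _ ?_)
    simp [revEdge, edgeId, invLetter]
  · left
    simp [edgeId]

theorem sum_mul_comp_eq_sum_fiber {Ω β : Type} [Fintype Ω] [Fintype β] [DecidableEq β] (w : Ω → ℝ)
    (f : Ω → β) (F : β → ℝ) :
    ∑ ω, w ω * F (f ω) = ∑ e, (∑ ω, if f ω = e then w ω else 0) * F e := by
  simp_rw [Finset.sum_mul]
  rw [Finset.sum_comm]
  refine Finset.sum_congr rfl fun ω _ => ?_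
  rw [Finset.sum_eq_single (f ω)]
  · simp
  · intro e _ he
    simp [he.symm]
  · simp

variable {α V κ : Type} [DecidableEq α] [Group V] [Fintype α] [Fintype V] [Fintype κ]
  [DecidableEq V] [DecidableEq κ]

/-- The edges of `G` whose tail lies in the class `c`. -/
def outEdges (cl : V → κ) (G : Finset (V × (α × Bool))) (c : κ) : Finset (V × (α × Bool)) :=
  G.filter fun e => cl e.1 = c

/-- As many edges of `G` enter a class as leave it, so the uniform weight on `G` is invariant under
drawing the next edge uniformly from the class of the head. -/
theorem card_inEdges {s : α → V} {cl : V → κ} {G : Finset (V × (α × Bool))}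
    (hrev : ∀ e ∈ G, revEdge s e ∈ G) (c : κ) :
    (G.filter fun e => cl (revEdge s e).1 = c).card = (outEdges cl G c).card := by
  refine Finset.card_bij (fun e _ => revEdge s e) (fun e he => ?_)
    (fun e _ e' _ h => (revEdge_involutive s).injective h) fun e he => ⟨revEdge s e, ?_, ?_⟩
  · rw [Finset.mem_filter] at he
    exact Finset.mem_filter.2 ⟨hrev e he.1, he.2⟩
  · have he := Finset.mem_filter.1 he
    refine Finset.mem_filter.2 ⟨hrev e he.1, ?_⟩
    rw [revEdge_involutive s e]
    exact he.2
  · exact revEdge_involutive s e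

/-- Bounds the mass lost per step, when the edge drawn is the reversal of the last one: every class
contributes at most one. -/
theorem sum_inv_card_outEdges_le {s : α → V} {cl : V → κ} {G : Finset (V × (α × Bool))}
    (hrev : ∀ e ∈ G, revEdge s e ∈ G) :
    ∑ e ∈ G, ((outEdges cl G (cl (revEdge s e).1)).card : ℝ)⁻¹ ≤ Fintype.card κ := by
  rw [← Finset.sum_fiberwise G fun e => cl (revEdge s e).1]
  calc _ ≤ ∑ c : κ, (1 : ℝ) := Finset.sum_le_sum fun c _ => ?_
    _ = _ := by simp
  rw [Finset.sum_congr rfl fun e he => by rw [(Finset.mem_filter.1 he).2], Finset.sum_const,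
    card_inEdges hrev, nsmul_eq_mul]
  exact mul_inv_le_one

/-- The mean distance from the head of `e` to the tail of an edge of `G` starting in its class. -/
noncomputable def meanJump (s : α → V) (cl : V → κ) (R : ℕ) (G : Finset (V × (α × Bool)))
    (e : V × (α × Bool)) : ℝ :=
  ((outEdges cl G (cl (revEdge s e).1)).card : ℝ)⁻¹ *
    ∑ e' ∈ outEdges cl G (cl (revEdge s e).1), (wordDist s R (revEdge s e).1 e'.1 : ℝ)

/-- Start with weight one on every good edge. Repeatedly draw the next edge uniformly among the good
edges leaving the class of the current head, and discard a reversal of the last edge. The words stay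
reduced, so each step adds its jump plus one to the norm. The marginals of the first and last edges
stay at most one, each step adds at most two to the load of an undirected edge, and discarding loses
mass at most the number of classes. -/
theorem exists_chain {s : α → V} {cl : V → κ} {R D : ℕ} {V₁ : Finset V}
    {G : Finset (V × (α × Bool))} (hG : G = goodEdges s cl V₁ D)
    (hdiam : ∀ x ∈ V₁, ∀ y ∈ V₁, cl x = cl y → wordDist s R x y ≤ D) (hDR : D < R)
    {Rel : V → V → Set (V × α) → Prop} (hrefl : ∀ x y, cl x = cl y → Rel x y ∅)
    (hedge : ∀ e, Rel e.1 (letterStep s e.1 e.2) {edgeId s e})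
    (htrans : ∀ {x y z A B}, Rel x y A → Rel y z B → Rel x z (A ∪ B)) (n : ℕ) :
    (n + 1) * (D + 1) ≤ R →
    ∃ (Ω : Type) (_ : Fintype Ω) (w : Ω → ℝ) (fst lst : Ω → V × (α × Bool))
      (z : Ω → FreeGroup α) (U : Ω → Set (V × α)),
      (∀ ω, 0 ≤ w ω) ∧
      (∀ ω, w ω ≠ 0 → fst ω ∈ G ∧ lst ω ∈ G ∧ Rel (fst ω).1 (revEdge s (lst ω)).1 (U ω) ∧
        (fst ω).1 * FreeGroup.lift s (z ω) = (revEdge s (lst ω)).1 ∧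
        (z ω).toWord.getLast? = some (lst ω).2 ∧ (z ω).norm ≤ (n + 1) * (D + 1)) ∧
      (∀ e, ∑ ω, (if fst ω = e then w ω else 0) ≤ 1) ∧
      (∀ e, ∑ ω, (if lst ω = e then w ω else 0) ≤ 1) ∧
      (∀ b, open Classical in ∑ ω, (if b ∈ U ω then w ω else 0) ≤ 2 * (n + 1)) ∧
      (G.card : ℝ) - n * Fintype.card κ ≤ ∑ ω, w ω ∧
      n * (∑ e ∈ G, meanJump s cl R G e - 2 * R * Fintype.card κ) ≤ ∑ ω, w ω * (z ω).norm := by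
  classical
  have hrev : ∀ e ∈ G, revEdge s e ∈ G := fun e he => by
    rw [hG] at he ⊢
    exact revEdge_mem_goodEdges he
  induction n with
  | zero =>
    intro hn
    refine ⟨V × (α × Bool), inferInstance, fun e => if e ∈ G then 1 else 0, id, id,
      fun e => FreeGroup.mk [e.2], fun e => {edgeId s e}, ?_, ?_, ?_, ?_, ?_, ?_, ?_⟩
    · intro e
      dsimp only
      split_ifs <;> simp
    · intro e he
      have he : e ∈ G := by_contra fun h => he (if_neg h)
      refine ⟨he, he, hedge e, rfl, by simp, ?_⟩
      rw [norm_mk_singleton]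
      omega
    · intro e
      simp only [id]
      rw [Finset.sum_ite_eq' Finset.univ e]
      simp only [Finset.mem_univ, if_true]
      split_ifs <;> simp
    · intro e
      simp only [id]
      rw [Finset.sum_ite_eq' Finset.univ e]
      simp only [Finset.mem_univ, if_true]
      split_ifs <;> simp
    · intro b
      have h1 : ∀ e, (if b ∈ ({edgeId s e} : Set (V × α)) then
          (if e ∈ G then (1 : ℝ) else 0) else 0) ≤ (if e = (b.1, (b.2, true)) then 1 else 0)
            + (if e = revEdge s (b.1, (b.2, true)) then 1 else 0) := by
        intro e
        by_cases hb : edgeId s e = b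
        · rcases edgeId_eq hb with h | h
          · rw [if_pos h]
            split_ifs <;> norm_num
          · rw [if_pos h]
            split_ifs <;> norm_num
        · rw [if_neg (by simpa using Ne.symm hb)]
          split_ifs <;> norm_num
      have h2 := Finset.sum_le_sum fun e (_ : e ∈ Finset.univ) => h1 e
      rw [Finset.sum_add_distrib, Finset.sum_ite_eq', Finset.sum_ite_eq'] at h2
      simp only [Finset.mem_univ, if_true] at h2
      refine le_trans (le_of_eq ?_) (h2.trans (by norm_num))
      exact Finset.sum_congr rfl fun e _ => by congr
    · simp
    · simp only [Nat.cast_zero, zero_mul]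
      exact Finset.sum_nonneg fun e _ => by split_ifs <;> simp
  | succ n ih =>
    intro hn
    have hn' : (n + 1) * (D + 1) ≤ R := le_trans (Nat.mul_le_mul_right _ (by omega)) hn
    obtain ⟨Ω, _, w, fst, lst, z, U, hw, hval, hfst, hlst, huse, hmass, hnorm⟩ := ih hn'
    set W : V × (α × Bool) → ℝ := fun e => ((outEdges cl G (cl (revEdge s e).1)).card : ℝ) with hW
    set nxt : V × (α × Bool) → Finset (V × (α × Bool)) := fun e =>
      outEdges cl G (cl (revEdge s e).1) with hnxt
    set A : V × (α × Bool) → ℝ := fun e => ∑ ω, if lst ω = e then w ω else 0 with hA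
    have hA0 : ∀ e, 0 ≤ A e := fun e => Finset.sum_nonneg fun ω _ => by
      split_ifs
      exacts [hw ω, le_rfl]
    have hAG : ∀ e, e ∉ G → A e = 0 := fun e he => Finset.sum_eq_zero fun ω _ => by
      split_ifs with h
      · by_contra h0
        exact he (h ▸ (hval ω h0).2.1)
      · rfl
    have hWpos : ∀ e ∈ G, 1 ≤ W e := fun e he => by
      have : revEdge s e ∈ outEdges cl G (cl (revEdge s e).1) :=
        Finset.mem_filter.2 ⟨hrev e he, rfl⟩
      have := Finset.card_pos.2 ⟨_, this⟩
      simp only [hW]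
      exact_mod_cast this
    have hW0 : ∀ e, 0 ≤ W e := fun e => Nat.cast_nonneg _
    have hfib : ∀ F : V × (α × Bool) → ℝ, ∑ ω, w ω * F (lst ω) = ∑ e ∈ G, A e * F e := by
      intro F
      rw [sum_mul_comp_eq_sum_fiber w lst F]
      exact (Finset.sum_subset (Finset.subset_univ G) fun e _ he => by
        rw [show (∑ ω, if lst ω = e then w ω else 0) = 0 from hAG e he, zero_mul]).symm
    have hjump : ∀ e ∈ G, ∀ e' ∈ nxt e, wordDist s R (revEdge s e).1 e'.1 ≤ D := by
      intro e he e' he'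
      obtain ⟨h1, h2⟩ := Finset.mem_filter.1 he'
      refine hdiam _ ?_ _ ?_ h2.symm
      · have := hrev e he
        rw [hG] at this
        exact (mem_goodEdges.1 this).1.1
      · rw [hG] at h1
        exact (mem_goodEdges.1 h1).1.1
    have hmean : ∀ e ∈ G, meanJump s cl R G e ≤ D := by
      intro e he
      rw [meanJump, inv_mul_le_iff₀ (zero_lt_one.trans_le (hWpos e he))]
      calc _ ≤ ∑ e' ∈ nxt e, (D : ℝ) :=
            Finset.sum_le_sum fun e' he' => Nat.cast_le.2 (hjump e he e' he')
        _ = _ := by rw [Finset.sum_const, nsmul_eq_mul]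
    have hword : ∀ ω, ∀ e', ∃ u : FreeGroup α, w ω ≠ 0 → e' ∈ nxt (lst ω) →
        u.norm = wordDist s R (revEdge s (lst ω)).1 e'.1 ∧
        (revEdge s (lst ω)).1 * FreeGroup.lift s u = e'.1 := by
      intro ω e'
      by_cases h : w ω ≠ 0 ∧ e' ∈ nxt (lst ω)
      · obtain ⟨u, hu⟩ := exists_of_wordDist_lt
          ((hjump _ (hval ω h.1).2.1 e' h.2).trans_lt hDR)
        exact ⟨u, fun _ _ => hu⟩
      · exact ⟨1, fun h1 h2 => (h ⟨h1, h2⟩).elim⟩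
    choose u hu using hword
    -- the weight of an extended chain vanishes unless the extension continues it without turning
    set w' : Ω × (V × (α × Bool)) → ℝ := fun q =>
      if q.2 ∈ (nxt (lst q.1)).erase (revEdge s (lst q.1)) then w q.1 * (W (lst q.1))⁻¹ else 0
      with hw'
    have hw'0 : ∀ q, 0 ≤ w' q := fun q => by
      simp only [hw']
      split_ifs
      · exact mul_nonneg (hw _) (inv_nonneg.2 (hW0 _))
      · exact le_rfl
    have hsum : ∀ f : Ω → V × (α × Bool) → ℝ, ∑ q : Ω × (V × (α × Bool)), w' q * f q.1 q.2
        = ∑ ω, w ω * ((W (lst ω))⁻¹ *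
          ∑ e' ∈ (nxt (lst ω)).erase (revEdge s (lst ω)), f ω e') := by
      intro f
      rw [Fintype.sum_prod_type]
      refine Finset.sum_congr rfl fun ω _ => ?_
      simp only [hw', ite_mul, zero_mul]
      rw [← Finset.sum_filter, Finset.filter_mem_eq_inter, Finset.univ_inter, Finset.mul_sum,
        Finset.mul_sum]
      exact Finset.sum_congr rfl fun e' _ => by ring
    have hone : ∀ e, (W e)⁻¹ * ∑ e' ∈ (nxt e).erase (revEdge s e), (1 : ℝ) ≤ 1 := by
      intro e
      rw [Finset.sum_const, nsmul_eq_mul, mul_one]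
      refine (mul_le_mul_of_nonneg_left (b := (((nxt e).erase (revEdge s e)).card : ℝ)) (c := W e)
        (Nat.cast_le.2 (Finset.card_erase_le)) (inv_nonneg.2 (hW0 e))).trans ?_
      exact inv_mul_le_one
    -- Each edge entering the class of `e` passes on to `e` at most the inverse of the number of
    -- edges leaving the class, which equals the number entering it.
    have hlst' : ∀ e, ∑ q : Ω × (V × (α × Bool)), (if q.2 = e then w' q else 0) ≤ 1 := by
      intro e
      have h1 : ∀ q : Ω × (V × (α × Bool)), (if q.2 = e then w' q else 0)
          = w' q * (if q.2 = e then 1 else 0) := fun q => by split_ifs <;> simp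
      simp_rw [h1]
      rw [hsum fun _ e' => if e' = e then 1 else 0,
        hfib fun d => (W d)⁻¹ * ∑ e' ∈ (nxt d).erase (revEdge s d), if e' = e then 1 else 0]
      calc _ ≤ ∑ d ∈ G, if cl (revEdge s d).1 = cl e.1 then
            ((outEdges cl G (cl e.1)).card : ℝ)⁻¹ else 0 := by
            refine Finset.sum_le_sum fun d hd => ?_
            rw [Finset.sum_ite_eq']
            by_cases hc : cl (revEdge s d).1 = cl e.1
            · rw [if_pos hc]
              refine (mul_le_mul (hlst d) (?_ : _ ≤ (W d)⁻¹) ?_ zero_le_one).trans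
                (le_of_eq ?_)
              · refine mul_le_of_le_one_right (inv_nonneg.2 (hW0 d)) ?_
                split_ifs <;> simp
              · refine mul_nonneg (inv_nonneg.2 (hW0 d)) ?_
                split_ifs <;> simp
              · rw [one_mul, hW]
                dsimp only
                rw [hc]
            · rw [if_neg, mul_zero, mul_zero, if_neg hc]
              intro h
              exact hc (Finset.mem_filter.1 (Finset.mem_of_mem_erase h)).2.symm
        _ ≤ 1 := by
            rw [← Finset.sum_filter, Finset.sum_const, card_inEdges hrev, nsmul_eq_mul]
            exact mul_inv_le_one
    have hsum0 : ∀ f : Ω → ℝ, (∀ ω, 0 ≤ f ω) →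
        ∑ q : Ω × (V × (α × Bool)), w' q * f q.1 ≤ ∑ ω, w ω * f ω := by
      intro f hf
      rw [hsum fun ω _ => f ω]
      refine Finset.sum_le_sum fun ω _ => mul_le_mul_of_nonneg_left ?_ (hw ω)
      have : ∑ _e' ∈ (nxt (lst ω)).erase (revEdge s (lst ω)), f ω
          = (∑ _e' ∈ (nxt (lst ω)).erase (revEdge s (lst ω)), (1 : ℝ)) * f ω := by
        rw [Finset.sum_mul, one_mul]
      rw [this, ← mul_assoc]
      exact mul_le_of_le_one_left (hf ω) (hone _)
    have hinv : ∑ ω, w ω * (W (lst ω))⁻¹ ≤ Fintype.card κ := by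
      rw [hfib fun e => (W e)⁻¹]
      refine (Finset.sum_le_sum fun e _ => ?_).trans (sum_inv_card_outEdges_le (cl := cl) hrev)
      exact mul_le_of_le_one_left (inv_nonneg.2 (hW0 e)) (hlst e)
    have hcard : ∀ ω, w ω * ((W (lst ω))⁻¹ *
        (((nxt (lst ω)).erase (revEdge s (lst ω))).card : ℝ)) = w ω - w ω * (W (lst ω))⁻¹ := by
      intro ω
      rcases eq_or_ne (w ω) 0 with h0 | h0
      · simp [h0]
      have hl := (hval ω h0).2.1
      have hmem : revEdge s (lst ω) ∈ nxt (lst ω) := Finset.mem_filter.2 ⟨hrev _ hl, rfl⟩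
      rw [Finset.card_erase_of_mem hmem, Nat.cast_sub (Finset.card_pos.2 ⟨_, hmem⟩)]
      have : W (lst ω) ≠ 0 := (zero_lt_one.trans_le (hWpos _ hl)).ne'
      have h2 : ((nxt (lst ω)).card : ℝ) = W (lst ω) := rfl
      rw [h2]
      field_simp
      simp
    -- No cancellation occurs: if `u` ended with the inverse of the new letter, the class would be
    -- seen from the new tail along the new edge; if it began with the inverse of the last letter,
    -- the class would be seen from the last head backwards; and if `u` is empty, only the discarded
    -- reversal cancels.
    have hnot : ∀ ω e', w ω ≠ 0 → e' ∈ (nxt (lst ω)).erase (revEdge s (lst ω)) →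
        (z ω * u ω e' * FreeGroup.mk [e'.2]).toWord
          = (z ω).toWord ++ ((u ω e').toWord ++ [e'.2]) := by
      intro ω e' h0 he'
      obtain ⟨-, hlG, -, -, hzl, -⟩ := hval ω h0
      obtain ⟨hne, hmem⟩ := Finset.mem_erase.1 he'
      obtain ⟨heG, hcl⟩ := Finset.mem_filter.1 hmem
      obtain ⟨hun, hul⟩ := hu ω e' h0 hmem
      have hD := hjump _ hlG e' hmem
      have hl1 := hlG
      have he1 := heG
      rw [hG, mem_goodEdges] at hl1 he1
      have h1 : (u ω e' * FreeGroup.mk [e'.2]).toWord = (u ω e').toWord ++ [e'.2] := by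
        rw [toWord_mul_of_not_cancel, toWord_mk_singleton]
        intro a ha b hb hab
        rw [toWord_mk_singleton] at hb
        obtain rfl : e'.2 = b := by simpa using hb
        have hx : e'.1 * FreeGroup.lift s (u ω e')⁻¹ = (revEdge s (lst ω)).1 := by
          rw [← hul]
          simp
        refine he1.1.2 ⟨(u ω e')⁻¹, ?_, ?_, ?_, ?_⟩
        · rw [FreeGroup.norm_inv_eq, hun]
          exact hD
        · rw [hx]
          exact hl1.2.1
        · rw [hx]
          exact hcl.symm
        · rw [head?_toWord_inv, Option.mem_def.1 ha, hab]
          rfl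
      rw [mul_assoc, toWord_mul_of_not_cancel, h1]
      intro a ha b hb hab
      rw [Option.mem_def, hzl, Option.some_inj] at ha
      rw [h1, Option.mem_def] at hb
      subst ha
      rcases hu' : (u ω e').toWord with _ | ⟨c, t⟩
      · have hu1 : u ω e' = 1 := FreeGroup.toWord_eq_nil_iff.1 hu'
        obtain rfl : e'.2 = b := by simpa [hu'] using hb
        refine hne (Prod.ext ?_ hab)
        rw [← hul, hu1]
        simp
      · obtain rfl : c = b := by simpa [hu'] using hb
        refine hl1.2.2 ⟨u ω e', ?_, ?_, ?_, ?_⟩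
        · rw [hun]
          exact hD
        · exact hul ▸ he1.1.1
        · exact (congrArg cl hul).trans hcl
        · rw [hu', hab]
          rfl
    have hnorm' : ∀ ω e', w ω ≠ 0 → e' ∈ (nxt (lst ω)).erase (revEdge s (lst ω)) →
        (z ω * u ω e' * FreeGroup.mk [e'.2]).norm
          = (z ω).norm + (wordDist s R (revEdge s (lst ω)).1 e'.1 + 1) := by
      intro ω e' h0 he'
      rw [← (hu ω e' h0 (Finset.mem_of_mem_erase he')).1]
      simp only [FreeGroup.norm, hnot ω e' h0 he', List.length_append, List.length_singleton]
    have hw0 : ∀ q, w' q ≠ 0 →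
        w q.1 ≠ 0 ∧ q.2 ∈ (nxt (lst q.1)).erase (revEdge s (lst q.1)) := by
      intro q hq
      simp only [hw'] at hq
      split_ifs at hq with h
      · exact ⟨left_ne_zero_of_mul hq, h⟩
      · exact absurd rfl hq
    refine ⟨Ω × (V × (α × Bool)), inferInstance, w', fun q => fst q.1, fun q => q.2,
      fun q => z q.1 * u q.1 q.2 * FreeGroup.mk [q.2.2], fun q => U q.1 ∪ ∅ ∪ {edgeId s q.2},
      hw'0, ?_, ?_, hlst', ?_, ?_, ?_⟩
    · intro q hq
      obtain ⟨h0, he'⟩ := hw0 q hq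
      obtain ⟨hfG, hlG, hrel, hz, hzl, hzn⟩ := hval q.1 h0
      have hmem := Finset.mem_of_mem_erase he'
      obtain ⟨heG, hcl⟩ := Finset.mem_filter.1 hmem
      refine ⟨hfG, heG, htrans (htrans hrel (hrefl _ _ hcl.symm)) (hedge q.2), ?_, ?_, ?_⟩
      · rw [map_mul, map_mul, ← mul_assoc, ← mul_assoc, hz, (hu q.1 q.2 h0 hmem).2]
        rfl
      · rw [hnot q.1 q.2 h0 he', ← List.append_assoc, List.getLast?_append]
        simp
      · rw [hnorm' q.1 q.2 h0 he']
        have := hjump _ hlG q.2 hmem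
        nlinarith
    · intro e
      have h1 : ∀ q : Ω × (V × (α × Bool)), (if fst q.1 = e then w' q else 0)
          = w' q * (if fst q.1 = e then 1 else 0) := fun q => by split_ifs <;> simp
      simp_rw [h1]
      refine (hsum0 (fun ω => if fst ω = e then 1 else 0) fun ω => by
        split_ifs <;> simp).trans (le_trans (le_of_eq ?_) (hfst e))
      simp
    · intro b
      have h1 : ∀ q : Ω × (V × (α × Bool)), (if b ∈ U q.1 ∪ ∅ ∪ {edgeId s q.2} then w' q else 0)
          ≤ w' q * (if b ∈ U q.1 then 1 else 0) + ((if q.2 = (b.1, (b.2, true)) then w' q else 0)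
            + (if q.2 = revEdge s (b.1, (b.2, true)) then w' q else 0)) := by
        intro q
        have hq := hw'0 q
        by_cases hb : b ∈ U q.1
        · rw [if_pos (by simp [hb]), if_pos hb, mul_one]
          have : 0 ≤ (if q.2 = (b.1, (b.2, true)) then w' q else 0)
            + (if q.2 = revEdge s (b.1, (b.2, true)) then w' q else 0) := by
            split_ifs <;> linarith
          linarith
        · by_cases hb' : edgeId s q.2 = b
          · rw [if_pos (by simp [hb']), if_neg hb]
            rcases edgeId_eq hb' with h | h
            · rw [if_pos h]
              split_ifs <;> linarith
            · rw [if_pos h]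
              split_ifs <;> linarith
          · rw [if_neg (by simp [hb, Ne.symm hb']), if_neg hb]
            split_ifs <;> linarith
      have h6 := Finset.sum_le_sum fun q (_ : q ∈ Finset.univ) => h1 q
      rw [Finset.sum_add_distrib, Finset.sum_add_distrib] at h6
      have h2 := hsum0 (fun ω => if b ∈ U ω then 1 else 0) fun ω => by split_ifs <;> simp
      have h3 : ∑ ω, w ω * (if b ∈ U ω then (1 : ℝ) else 0) ≤ 2 * (n + 1) := by
        refine le_trans (le_of_eq ?_) (huse b)
        simp
      have h4 := hlst' (b.1, (b.2, true))
      have h5 := hlst' (revEdge s (b.1, (b.2, true)))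
      refine le_trans (le_of_eq ?_) (h6.trans ?_)
      · exact Finset.sum_congr rfl fun q _ => by congr
      · push_cast
        linarith
    · have h1 := hsum fun _ _ => 1
      simp only [mul_one, Finset.sum_const, nsmul_eq_mul, hcard, Finset.sum_sub_distrib] at h1
      rw [h1]
      push_cast
      linarith
    · have h1 : ∑ q : Ω × (V × (α × Bool)), w' q *
          ((z q.1).norm + wordDist s R (revEdge s (lst q.1)).1 q.2.1 : ℝ)
          ≤ ∑ q : Ω × (V × (α × Bool)), w' q *
            ((z q.1 * u q.1 q.2 * FreeGroup.mk [q.2.2]).norm : ℝ) := by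
        refine Finset.sum_le_sum fun q _ => ?_
        rcases eq_or_ne (w' q) 0 with h0 | h0
        · simp [h0]
        · obtain ⟨h2, h3⟩ := hw0 q h0
          rw [hnorm' q.1 q.2 h2 h3]
          exact mul_le_mul_of_nonneg_left (by push_cast; linarith) (hw'0 q)
      refine le_trans ?_ h1
      rw [hsum fun ω e' => ((z ω).norm + wordDist s R (revEdge s (lst ω)).1 e'.1 : ℝ)]
      have h2 : ∀ ω, w ω * ((W (lst ω))⁻¹ * ∑ e' ∈ (nxt (lst ω)).erase (revEdge s (lst ω)),
          ((z ω).norm + wordDist s R (revEdge s (lst ω)).1 e'.1 : ℝ))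
          = w ω * (z ω).norm - w ω * (W (lst ω))⁻¹ * (z ω).norm
            + w ω * meanJump s cl R G (lst ω) := by
        intro ω
        -- Discarding the reversal loses no jump length, because its tail is the current head.
        have h3 : ∑ e' ∈ (nxt (lst ω)).erase (revEdge s (lst ω)),
            (wordDist s R (revEdge s (lst ω)).1 e'.1 : ℝ)
            = ∑ e' ∈ nxt (lst ω), (wordDist s R (revEdge s (lst ω)).1 e'.1 : ℝ) :=
          Finset.sum_erase _ (by simp)
        rw [Finset.sum_add_distrib, h3, Finset.sum_const, nsmul_eq_mul, mul_add, mul_add,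
          ← mul_assoc (W (lst ω))⁻¹, ← mul_assoc, hcard]
        rw [meanJump]
        ring
      simp_rw [h2]
      rw [Finset.sum_add_distrib, Finset.sum_sub_distrib, hfib fun e => meanJump s cl R G e]
      -- First loss: discarded mass carries norm at most `(n + 1) * (D + 1)`.
      have h3 : ∑ ω, w ω * (W (lst ω))⁻¹ * (z ω).norm
          ≤ (n + 1) * (D + 1) * Fintype.card κ := by
        calc _ ≤ ∑ ω, w ω * (W (lst ω))⁻¹ * ((n + 1) * (D + 1)) := by
              refine Finset.sum_le_sum fun ω _ => ?_
              rcases eq_or_ne (w ω) 0 with h0 | h0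
              · simp [h0]
              · refine mul_le_mul_of_nonneg_left ?_ (mul_nonneg (hw _) (inv_nonneg.2 (hW0 _)))
                exact_mod_cast (hval ω h0).2.2.2.2.2
          _ ≤ _ := by
              rw [← Finset.sum_mul, mul_comm]
              exact mul_le_mul_of_nonneg_left hinv (by positivity)
      -- Second loss: the last-edge marginal misses at most `n * Fintype.card κ` of the uniform
      -- weight, and jumps are at most `D`.
      have h4 : ∑ e ∈ G, meanJump s cl R G e - D * (n * Fintype.card κ)
          ≤ ∑ e ∈ G, A e * meanJump s cl R G e := by
        have h5 : ∑ e ∈ G, A e = ∑ ω, w ω := by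
          have := hfib fun _ => 1
          simpa using this.symm
        have h6 : ∑ e ∈ G, (1 - A e) * meanJump s cl R G e ≤ ∑ e ∈ G, (1 - A e) * D :=
          Finset.sum_le_sum fun e he =>
            mul_le_mul_of_nonneg_left (hmean e he) (sub_nonneg.2 (hlst e))
        rw [← Finset.sum_mul, Finset.sum_sub_distrib, h5] at h6
        simp_rw [sub_mul, one_mul] at h6
        rw [Finset.sum_sub_distrib] at h6
        simp only [Finset.sum_const, nsmul_eq_mul, mul_one] at h6
        have h7 : ((G.card : ℝ) - ∑ ω, w ω) * D ≤ n * Fintype.card κ * D :=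
          mul_le_mul_of_nonneg_right (by linarith) (Nat.cast_nonneg _)
        linarith
      have h5 : ((n : ℝ) + 1 + 1) * (D + 1) ≤ R := by exact_mod_cast hn
      have h6 : ((n : ℝ) + 1) * (D + 1) * Fintype.card κ + D * (n * Fintype.card κ)
          ≤ 2 * R * Fintype.card κ := by
        have h7 : ((n : ℝ) + 1) * (D + 1) + D * n ≤ 2 * R := by
          have : (0 : ℝ) ≤ n := Nat.cast_nonneg _
          have : (0 : ℝ) ≤ D := Nat.cast_nonneg _
          nlinarith
        have := mul_le_mul_of_nonneg_right h7 (Nat.cast_nonneg (α := ℝ) (Fintype.card κ))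
        linarith
      push_cast
      linarith

end Chain

/-! ### Mass moved far by resampling within classes. -/

section FarPairs

variable {α V κ : Type} [DecidableEq α] [Group V] [Fintype α] [Fintype V] [Fintype κ]
  [DecidableEq κ]

/-- The number of elements of the class of `x`. -/
def classSize (cl : V → κ) (x : V) : ℕ := (Finset.univ.filter fun y => cl y = cl x).card

theorem classSize_pos (cl : V → κ) (x : V) : 0 < classSize cl x :=
  Finset.card_pos.2 ⟨x, by simp⟩

theorem classSize_congr {cl : V → κ} {x y : V} (h : cl y = cl x) :
    classSize cl y = classSize cl x := by
  simp [classSize, h]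

open Classical in
/-- The probability that a uniform element of the class of `x` is `y`, if `y` is at distance more
than `ρ` from `x`, and zero otherwise. -/
noncomputable def farKernel (s : α → V) (cl : V → κ) (R : ℕ) (ρ : ℝ) (x y : V) : ℝ :=
  if cl y = cl x ∧ ρ < wordDist s R x y then (classSize cl x : ℝ)⁻¹ else 0

/-- The expected number of vertices that a uniform resampling within their class moves by more than
`ρ`. -/
noncomputable def farMass (s : α → V) (cl : V → κ) (R : ℕ) (ρ : ℝ) : ℝ :=
  ∑ x, ∑ y, farKernel s cl R ρ x y

theorem farKernel_nonneg (s : α → V) (cl : V → κ) (R : ℕ) (ρ : ℝ) (x y : V) :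
    0 ≤ farKernel s cl R ρ x y := by
  rw [farKernel]
  split_ifs <;> positivity

theorem farKernel_comm (s : α → V) (cl : V → κ) (R : ℕ) (ρ : ℝ) (x y : V) :
    farKernel s cl R ρ x y = farKernel s cl R ρ y x := by
  rw [farKernel, farKernel, wordDist_comm s R y x]
  by_cases h : cl y = cl x
  · rw [classSize_congr h]
    simp [h]
  · simp [h, Ne.symm h]

theorem sum_farKernel_le_one (s : α → V) (cl : V → κ) (R : ℕ) (ρ : ℝ) (x : V) :
    ∑ y, farKernel s cl R ρ x y ≤ 1 := by
  classical
  calc _ ≤ ∑ y, if cl y = cl x then (classSize cl x : ℝ)⁻¹ else 0 := by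
        refine Finset.sum_le_sum fun y _ => ?_
        rw [farKernel]
        split_ifs with h1 h2 h2
        · exact le_rfl
        · exact absurd h1.1 h2
        · positivity
        · exact le_rfl
    _ = (classSize cl x : ℝ) * (classSize cl x : ℝ)⁻¹ := by
        rw [← Finset.sum_filter, Finset.sum_const, nsmul_eq_mul, classSize]
    _ ≤ 1 := mul_inv_le_one

theorem sum_inv_classSize_le (cl : V → κ) :
    ∑ x, (classSize cl x : ℝ)⁻¹ ≤ Fintype.card κ := by
  rw [← Finset.sum_fiberwise Finset.univ cl]
  calc _ ≤ ∑ c : κ, (1 : ℝ) := Finset.sum_le_sum fun c _ => ?_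
    _ = _ := by simp
  have : ∀ x ∈ Finset.univ.filter (fun x => cl x = c), (classSize cl x : ℝ)⁻¹
      = ((Finset.univ.filter fun x => cl x = c).card : ℝ)⁻¹ := fun x hx => by
    rw [classSize, (Finset.mem_filter.1 hx).2]
  rw [Finset.sum_congr rfl this, Finset.sum_const, nsmul_eq_mul]
  exact mul_inv_le_one

/-- A uniform member of the class of `x` is near `x` with probability at most the ball size over the
class size, and the inverse class sizes sum to at most the number of classes. -/
theorem le_farMass (s : α → V) (cl : V → κ) (R : ℕ) (ρ : ℝ) (hρ0 : 0 ≤ ρ) (hρ : ρ < R) :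
    (Fintype.card V : ℝ) - Fintype.card κ * (2 * Fintype.card α + 1 : ℝ) ^ ⌊ρ⌋₊
      ≤ farMass s cl R ρ := by
  classical
  have hx : ∀ x, 1 - (2 * Fintype.card α + 1 : ℝ) ^ ⌊ρ⌋₊ * (classSize cl x : ℝ)⁻¹
      ≤ ∑ y, farKernel s cl R ρ x y := by
    intro x
    have h1 : (1 : ℝ) = ∑ y, if cl y = cl x then (classSize cl x : ℝ)⁻¹ else 0 := by
      rw [← Finset.sum_filter, Finset.sum_const, nsmul_eq_mul, ← classSize,
        mul_inv_cancel₀ (Nat.cast_ne_zero.2 (classSize_pos cl x).ne')]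
    have h2 : ∑ y, (if wordDist s R x y ≤ ⌊ρ⌋₊ then (classSize cl x : ℝ)⁻¹ else 0)
        ≤ (2 * Fintype.card α + 1 : ℝ) ^ ⌊ρ⌋₊ * (classSize cl x : ℝ)⁻¹ := by
      rw [← Finset.sum_filter, Finset.sum_const, nsmul_eq_mul]
      refine mul_le_mul_of_nonneg_right ?_ (by positivity)
      exact_mod_cast card_wordDist_le s R ⌊ρ⌋₊ ((Nat.floor_lt hρ0).2 hρ) x
    nth_rw 1 [h1]
    rw [sub_le_iff_le_add]
    refine le_trans ?_ (add_le_add_right h2 _)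
    rw [← Finset.sum_add_distrib]
    refine Finset.sum_le_sum fun y _ => ?_
    have h0 : (0 : ℝ) ≤ (classSize cl x : ℝ)⁻¹ := by positivity
    rw [farKernel]
    by_cases hc : cl y = cl x
    · by_cases hd : ρ < wordDist s R x y
      · rw [if_pos hc, if_pos ⟨hc, hd⟩]
        split_ifs <;> linarith
      · rw [if_pos hc, if_neg (fun h => hd h.2), if_pos (Nat.le_floor (not_lt.1 hd))]
        linarith
    · rw [if_neg hc, if_neg (fun h => hc h.1)]
      split_ifs <;> linarith
  have h1 := Finset.sum_le_sum fun x (_ : x ∈ Finset.univ) => hx x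
  rw [Finset.sum_sub_distrib, ← Finset.mul_sum] at h1
  simp only [Finset.sum_const, Finset.card_univ, nsmul_eq_mul, mul_one] at h1
  have h2 := mul_le_mul_of_nonneg_left (sum_inv_classSize_le cl)
    (show (0 : ℝ) ≤ (2 * Fintype.card α + 1 : ℝ) ^ ⌊ρ⌋₊ by positivity)
  rw [farMass]
  linarith

/-- Take as centre of each class a member with the least far mass; it does at least as well as the
average member. -/
theorem exists_centers [Nonempty V] (s : α → V) (cl : V → κ) (R : ℕ) (ρ : ℝ) :
    ∃ ctr : κ → V, ((Finset.univ.filter fun x => ¬ (wordDist s R (ctr (cl x)) x : ℝ) ≤ ρ).card : ℝ)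
      ≤ farMass s cl R ρ := by
  classical
  have h : ∀ c : κ, ∃ z : V, ∀ x, cl x = c → cl z = c ∧
      ∑ y, farKernel s cl R ρ z y ≤ ∑ y, farKernel s cl R ρ x y := by
    intro c
    by_cases hc : ∃ x, cl x = c
    · obtain ⟨x, hx⟩ := hc
      obtain ⟨z, hz, hle⟩ := Finset.exists_min_image (Finset.univ.filter fun x => cl x = c)
        (fun x => ∑ y, farKernel s cl R ρ x y) ⟨x, by simp [hx]⟩
      exact ⟨z, fun y hy => ⟨by simpa using hz, hle y (by simp [hy])⟩⟩
    · exact ⟨Classical.arbitrary V, fun x hx => (hc ⟨x, hx⟩).elim⟩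
  choose ctr hctr using h
  refine ⟨ctr, ?_⟩
  calc ((Finset.univ.filter fun x => ¬ (wordDist s R (ctr (cl x)) x : ℝ) ≤ ρ).card : ℝ)
      = ∑ y, if ¬ (wordDist s R (ctr (cl y)) y : ℝ) ≤ ρ then (1 : ℝ) else 0 := by
        rw [← Finset.sum_filter]
        simp
    _ = ∑ y, ∑ x, farKernel s cl R ρ (ctr (cl x)) y := by
        refine Finset.sum_congr rfl fun y _ => ?_
        have h1 : ∀ x, farKernel s cl R ρ (ctr (cl x)) y
            = if cl x = cl y then (if ¬ (wordDist s R (ctr (cl y)) y : ℝ) ≤ ρ then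
              (classSize cl y : ℝ)⁻¹ else 0) else 0 := by
          intro x
          have hx := (hctr (cl x) x rfl).1
          rw [farKernel, hx]
          by_cases hxy : cl x = cl y
          · rw [classSize_congr (hx.trans hxy), hxy]
            simp
          · simp [hxy, Ne.symm hxy]
        simp_rw [h1]
        rw [← Finset.sum_filter, Finset.sum_const, nsmul_eq_mul, ← classSize]
        split_ifs
        · simp
        · rw [mul_inv_cancel₀ (Nat.cast_ne_zero.2 (classSize_pos cl y).ne')]
    _ = ∑ x, ∑ y, farKernel s cl R ρ (ctr (cl x)) y := Finset.sum_comm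
    _ ≤ farMass s cl R ρ := Finset.sum_le_sum fun x _ => (hctr (cl x) x rfl).2

/-- At most `2 * Fintype.card α` good edges leave each vertex of a class, so a mean jump is at least
`ρ / (2 * Fintype.card α)` times the far mass summed over good edges. Over all pairs of directed
edges this mass is `(2 * Fintype.card α) ^ 2 * farMass`; each missing edge removes a row and a
column of sum at most `2 * Fintype.card α`. -/
theorem le_sum_meanJump [DecidableEq V] (s : α → V) (cl : V → κ) (R : ℕ) (ρ : ℝ) (hρ : 0 ≤ ρ)
    (G : Finset (V × (α × Bool))) (hrev : ∀ e ∈ G, revEdge s e ∈ G) (hα : 0 < Fintype.card α) :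
    ρ * (2 * Fintype.card α * farMass s cl R ρ
      - 2 * (2 * Fintype.card α * Fintype.card V - G.card)) ≤ ∑ e ∈ G, meanJump s cl R G e := by
  classical
  set r : ℝ := ((Fintype.card α : ℕ) : ℝ) with hr
  have hr0 : 0 < r := Nat.cast_pos.2 hα
  have hcardL : (Fintype.card (α × Bool) : ℝ) = 2 * r := by
    simp [hr, mul_comm]
  set K := farKernel s cl R ρ with hK
  have h1 : ∑ e ∈ G, meanJump s cl R G e = ∑ e ∈ G, ((outEdges cl G (cl e.1)).card : ℝ)⁻¹ *
      ∑ e' ∈ outEdges cl G (cl e.1), (wordDist s R e.1 e'.1 : ℝ) :=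
    Finset.sum_bij (fun e _ => revEdge s e) hrev
      (fun e _ e' _ h => (revEdge_involutive s).injective h)
      (fun e he => ⟨revEdge s e, hrev e he, revEdge_involutive s e⟩) fun e _ => rfl
  have h2 : ∀ e ∈ G, ρ * (2 * r)⁻¹ * ∑ e' ∈ G, K e.1 e'.1
      ≤ ((outEdges cl G (cl e.1)).card : ℝ)⁻¹ *
        ∑ e' ∈ outEdges cl G (cl e.1), (wordDist s R e.1 e'.1 : ℝ) := by
    intro e he
    have hW : ((outEdges cl G (cl e.1)).card : ℝ) ≤ 2 * r * classSize cl e.1 := by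
      have : (outEdges cl G (cl e.1)).card
          ≤ ((Finset.univ.filter fun y => cl y = cl e.1) ×ˢ
            (Finset.univ : Finset (α × Bool))).card :=
        Finset.card_le_card fun e' he' => by simp [(Finset.mem_filter.1 he').2]
      rw [Finset.card_product, Finset.card_univ, ← classSize] at this
      calc ((outEdges cl G (cl e.1)).card : ℝ)
          ≤ ((classSize cl e.1 * Fintype.card (α × Bool) : ℕ) : ℝ) := Nat.cast_le.2 this
        _ = _ := by rw [Nat.cast_mul, hcardL, mul_comm]
    have hWpos : (0 : ℝ) < (outEdges cl G (cl e.1)).card :=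
      Nat.cast_pos.2 (Finset.card_pos.2 ⟨e, Finset.mem_filter.2 ⟨he, rfl⟩⟩)
    have hinv := inv_anti₀ hWpos hW
    have h3 : ∑ e' ∈ G, K e.1 e'.1 = ∑ e' ∈ outEdges cl G (cl e.1), K e.1 e'.1 := by
      rw [outEdges, Finset.sum_filter]
      refine Finset.sum_congr rfl fun e' _ => ?_
      by_cases hc : cl e'.1 = cl e.1
      · simp [hc]
      · simp [hK, farKernel, hc]
    rw [h3, mul_assoc, mul_left_comm]
    calc (2 * r)⁻¹ * (ρ * ∑ e' ∈ outEdges cl G (cl e.1), K e.1 e'.1)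
        = (2 * r * classSize cl e.1)⁻¹ *
          ∑ e' ∈ outEdges cl G (cl e.1), ρ * (K e.1 e'.1 * classSize cl e.1) := by
          have : (classSize cl e.1 : ℝ) ≠ 0 := Nat.cast_ne_zero.2 (classSize_pos cl e.1).ne'
          rw [← Finset.mul_sum, ← Finset.sum_mul]
          field_simp
      _ ≤ _ := by
          refine mul_le_mul hinv (Finset.sum_le_sum fun e' _ => ?_) (Finset.sum_nonneg fun e' _ =>
            mul_nonneg hρ (mul_nonneg (farKernel_nonneg _ _ _ _ _ _) (by positivity)))
            (by positivity)
          rw [hK, farKernel]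
          split_ifs with h
          · rw [inv_mul_cancel₀ (Nat.cast_ne_zero.2 (classSize_pos cl e.1).ne'), mul_one]
            exact h.2.le
          · simp
  have hone : ∀ e : V × (α × Bool), ∑ e' : V × (α × Bool), K e.1 e'.1 ≤ 2 * r := by
    intro e
    rw [Fintype.sum_prod_type]
    simp only [Finset.sum_const, Finset.card_univ, nsmul_eq_mul]
    rw [← Finset.mul_sum, hcardL]
    exact mul_le_of_le_one_right (by positivity) (sum_farKernel_le_one s cl R ρ e.1)
  have hall : ∑ e : V × (α × Bool), ∑ e' : V × (α × Bool), K e.1 e'.1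
      = (2 * r) * ((2 * r) * farMass s cl R ρ) := by
    simp only [Fintype.sum_prod_type, Finset.sum_const, Finset.card_univ, nsmul_eq_mul]
    rw [← Finset.mul_sum, hcardL]
    simp only [← Finset.mul_sum]
    rfl
  have hG : (Gᶜ.card : ℝ) = 2 * r * Fintype.card V - G.card := by
    have := Finset.card_add_card_compl G
    rw [Fintype.card_prod] at this
    have h : ((G.card + Gᶜ.card : ℕ) : ℝ) = ((Fintype.card V * Fintype.card (α × Bool) : ℕ) : ℝ) :=
      congrArg _ this
    rw [Nat.cast_add, Nat.cast_mul, hcardL] at h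
    linarith
  have hK0 : ∀ x y, 0 ≤ K x y := farKernel_nonneg s cl R ρ
  have h4 : (2 * r) * ((2 * r) * farMass s cl R ρ) - 2 * ((2 * r) * Gᶜ.card)
      ≤ ∑ e ∈ G, ∑ e' ∈ G, K e.1 e'.1 := by
    have a1 : ∑ e : V × (α × Bool), ∑ e' : V × (α × Bool), K e.1 e'.1
        = ∑ e ∈ G, ∑ e' ∈ G, K e.1 e'.1 + ∑ e ∈ G, ∑ e' ∈ Gᶜ, K e.1 e'.1
          + ∑ e ∈ Gᶜ, ∑ e' : V × (α × Bool), K e.1 e'.1 := by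
      rw [← Finset.sum_add_distrib, ← Finset.sum_add_sum_compl G]
      congr 1
      exact Finset.sum_congr rfl fun e _ => (Finset.sum_add_sum_compl G _).symm
    have a2 : ∑ e ∈ Gᶜ, ∑ e' : V × (α × Bool), K e.1 e'.1 ≤ (2 * r) * Gᶜ.card := by
      refine (Finset.sum_le_sum fun e _ => hone e).trans (le_of_eq ?_)
      rw [Finset.sum_const, nsmul_eq_mul, mul_comm]
    have a3 : ∑ e ∈ G, ∑ e' ∈ Gᶜ, K e.1 e'.1 ≤ (2 * r) * Gᶜ.card := by
      rw [Finset.sum_comm]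
      refine le_trans ?_ a2
      refine Finset.sum_le_sum fun e' _ => ?_
      refine (Finset.sum_le_sum_of_subset_of_nonneg (Finset.subset_univ G)
        fun e _ _ => hK0 _ _).trans (le_of_eq ?_)
      exact Finset.sum_congr rfl fun e _ => farKernel_comm s cl R ρ _ _
    linarith
  rw [h1]
  refine le_trans ?_ (Finset.sum_le_sum h2)
  rw [← Finset.mul_sum]
  refine le_trans (le_of_eq ?_) (mul_le_mul_of_nonneg_left h4 (by positivity))
  rw [hG]
  field_simp

/-- Before the first drop by a factor 16, each step loses less than that factor. -/
theorem exists_scale (Ψ : ℕ → ℝ) (N : ℝ) (h0 : N ≤ Ψ 0) (I : ℕ) :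
    N / 16 ^ I ≤ Ψ I ∨ ∃ i < I, Ψ (i + 1) ≤ Ψ i / 16 ∧ N / 16 ^ i ≤ Ψ i := by
  induction I with
  | zero => left; simpa using h0
  | succ I ih =>
    rcases ih with h | ⟨i, hi, h⟩
    · by_cases h1 : Ψ (I + 1) ≤ Ψ I / 16
      · exact Or.inr ⟨I, by omega, h1, h⟩
      · left
        push Not at h1
        refine le_trans ?_ h1.le
        rw [pow_succ, ← div_div]
        linarith
    · exact Or.inr ⟨i, by omega, h⟩

end FarPairs

/-! ### The shortcut graph and families of walks in its contractions. -/

section Shortcut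

theorem CapGraph.Joins.contract {V E : Type} (G : CapGraph V E) (F : Setoid V) {u v : V} {e : E}
    (h : G.ends e = s(u, v)) :
    (G.contract F).Joins (Quotient.mk F u) (Quotient.mk F v) {e' | e'.1 = e} := by
  by_cases hd : ((G.ends e).map (Quotient.mk F)).IsDiag
  · have : Quotient.mk F u = Quotient.mk F v := by simpa [h] using hd
    rw [this]
    exact (CapGraph.Joins.refl _ _).mono (Set.empty_subset _)
  · have h1 : (G.contract F).Joins (Quotient.mk F u) (Quotient.mk F v) {⟨e, hd⟩} :=
      CapGraph.Joins.of_edge (by simp [CapGraph.contract, h])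
    refine h1.mono ?_
    rintro _ rfl
    rfl

variable {α V : Type} [DecidableEq α] [Group V] [Fintype α] [Fintype V]

/-- The Cayley graph of `s`, with capacities `M`, together with an edge of capacity one from each
vertex `x` to `π x`. -/
def shortcutGraph (s : α → V) (π : V → V) (M : ℝ≥0) (hM : 0 < M) : CapGraph V ((V × α) ⊕ V) where
  ends e := e.elim (fun b => s(b.1, b.1 * s b.2)) fun x => s(x, π x)
  cap e := e.elim (fun _ => M) fun _ => 1
  cap_pos e := by cases e <;> simp [hM]

/-- Edge lengths of the shortcut graph. -/
def shortcutLength (r₀ : ℕ) (e : (V × α) ⊕ V) : ℝ≥0 :=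
  e.elim (fun _ => 1) fun _ => r₀

/-- Dual feasibility of `shortcutLength`: no edge is shorter than the distance of its ends. -/
theorem wordDist_le_sum_edges {s : α → V} {π : V → V} {M : ℝ≥0} {hM : 0 < M} {R r₀ : ℕ}
    (hπ : ∀ x, wordDist s R x (π x) ≤ r₀) {u v : V}
    (p : CapGraph.Walk (shortcutGraph s π M hM) u v) :
    (wordDist s R u v : ℝ≥0) ≤ (p.edges.map (shortcutLength r₀)).sum := by
  induction p with
  | nil u => simp [CapGraph.Walk.edges]
  | @cons u v w e h p ih =>
    have h1 : (wordDist s R u v : ℝ≥0) ≤ shortcutLength r₀ e := by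
      rcases e with ⟨x, a⟩ | x
      · have hx : wordDist s R x (x * s a) ≤ 1 := by
          have := wordDist_letterStep_le s R x (a, true)
          simpa [letterStep] using this
        simp only [shortcutGraph, Sum.elim_inl, Sym2.eq_iff] at h
        simp only [shortcutLength, Sum.elim_inl]
        rcases h with ⟨rfl, rfl⟩ | ⟨rfl, rfl⟩
        · exact_mod_cast hx
        · rw [wordDist_comm]
          exact_mod_cast hx
      · simp only [shortcutGraph, Sum.elim_inr, Sym2.eq_iff] at h
        simp only [shortcutLength, Sum.elim_inr]
        rcases h with ⟨rfl, rfl⟩ | ⟨rfl, rfl⟩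
        · exact_mod_cast hπ _
        · rw [wordDist_comm]
          exact_mod_cast hπ _
    rw [CapGraph.Walk.edges, List.map_cons, List.sum_cons]
    calc (wordDist s R u w : ℝ≥0) ≤ wordDist s R u v + wordDist s R v w := by
          exact_mod_cast wordDist_triangle s R u v w
      _ ≤ _ := add_le_add h1 ih

theorem sum_cap_mul_shortcutLength (s : α → V) (π : V → V) (M : ℝ≥0) (hM : 0 < M) (r₀ : ℕ) :
    ∑ e, ((shortcutGraph s π M hM).cap e : ℝ) * shortcutLength r₀ e
      = Fintype.card V * (Fintype.card α * M + r₀) := by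
  simp [Fintype.sum_sum_type, shortcutGraph, shortcutLength]
  ring

/-- Joining in the contraction of the shortcut graph through given edges of the Cayley graph. -/
def ContractJoins (s : α → V) (π : V → V) (M : ℝ≥0) (hM : 0 < M) (F : Setoid V) (x y : V)
    (A : Set (V × α)) : Prop :=
  ((shortcutGraph s π M hM).contract F).Joins (Quotient.mk F x) (Quotient.mk F y)
    {e | ∃ b ∈ A, e.1 = Sum.inl b}

theorem ContractJoins.refl {s : α → V} {π : V → V} {M : ℝ≥0} {hM : 0 < M} {F : Setoid V} {x y : V}
    (h : Quotient.mk F x = Quotient.mk F y) : ContractJoins s π M hM F x y ∅ := by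
  rw [ContractJoins, h]
  exact (CapGraph.Joins.refl _ _).mono (Set.empty_subset _)

theorem ContractJoins.trans {s : α → V} {π : V → V} {M : ℝ≥0} {hM : 0 < M} {F : Setoid V}
    {x y z : V} {A B : Set (V × α)} (h₁ : ContractJoins s π M hM F x y A)
    (h₂ : ContractJoins s π M hM F y z B) : ContractJoins s π M hM F x z (A ∪ B) := by
  refine (CapGraph.Joins.trans h₁ h₂).mono ?_
  rintro e (⟨b, hb, he⟩ | ⟨b, hb, he⟩)
  · exact ⟨b, Or.inl hb, he⟩
  · exact ⟨b, Or.inr hb, he⟩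

theorem ContractJoins.edge (s : α → V) (π : V → V) (M : ℝ≥0) (hM : 0 < M) (F : Setoid V)
    (e : V × (α × Bool)) :
    ContractJoins s π M hM F e.1 (letterStep s e.1 e.2) {edgeId s e} := by
  have h : (shortcutGraph s π M hM).ends (Sum.inl (edgeId s e))
      = s(e.1, letterStep s e.1 e.2) := by
    obtain ⟨x, a, c⟩ := e
    cases c
    · simp [shortcutGraph, edgeId, letterStep]
    · simp [shortcutGraph, edgeId, letterStep]
  exact (CapGraph.Joins.contract _ F h).mono fun e' he' => ⟨_, rfl, he'⟩

/-- The word distance between terminals. -/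
noncomputable def terminalDist (s : α → V) (R : ℕ) (T : Finset V) (t t' : T) : ℝ≥0 :=
  (wordDist s R t.1 t'.1 : ℕ)

/-- Walks between arbitrary vertices are prolonged to terminals by the shortcuts at both ends. The
bounds 1/2 on the marginals keep these within capacity one, and each prolongation costs at most `2 *
r₀` of distance. -/
theorem carriesLength_of_family {s : α → V} {π : V → V} {M : ℝ≥0} {hM : 0 < M} {F : Setoid V}
    {R r₀ : ℕ} {T : Finset V} (hπT : ∀ x, π x ∈ T) (hπ : ∀ x, wordDist s R x (π x) ≤ r₀)
    {Ω : Type} [Fintype Ω] (p : Ω → ℝ) (hp : ∀ ω, 0 ≤ p ω) (x y : Ω → V) (U : Ω → Set (V × α))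
    (hU : ∀ ω, p ω ≠ 0 → ContractJoins s π M hM F (x ω) (y ω) (U ω))
    (hx : ∀ v, open Classical in ∑ ω, (if x ω = v then p ω else 0) ≤ 1 / 2)
    (hy : ∀ v, open Classical in ∑ ω, (if y ω = v then p ω else 0) ≤ 1 / 2)
    (huse : ∀ b, open Classical in ∑ ω, (if b ∈ U ω then p ω else 0) ≤ M) {X : ℝ}
    (hX : X ≤ ∑ ω, p ω * (wordDist s R (x ω) (y ω) - 2 * r₀)) :
    ((shortcutGraph s π M hM).contract F).CarriesLength (contractTerminal T F)
      (terminalDist s R T) X := by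
  classical
  -- Walks are only available where the weight is nonzero.
  let Ω' : Type := {ω : Ω // p ω ≠ 0}
  have hsub : ∀ f : Ω → ℝ, (∀ ω, p ω = 0 → f ω = 0) → ∑ ω : Ω', f ω.1 = ∑ ω, f ω := by
    intro f hf
    rw [← Finset.sum_subtype (Finset.univ.filter fun ω => p ω ≠ 0) (fun ω => by simp) f]
    exact Finset.sum_subset (Finset.subset_univ _) fun ω _ h => hf ω (by simpa using h)
  refine ⟨Ω', inferInstance, fun ω => (p ω.1).toNNReal, fun ω => ⟨π (x ω.1), hπT _⟩,
    fun ω => ⟨π (y ω.1), hπT _⟩,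
    fun ω => {e | e.1 = Sum.inr (x ω.1)} ∪ {e | ∃ b ∈ U ω.1, e.1 = Sum.inl b}
      ∪ {e | e.1 = Sum.inr (y ω.1)}, fun ω => ?_, ?_, ?_⟩
  · have h1 : (shortcutGraph s π M hM).ends (Sum.inr (x ω.1)) = s(π (x ω.1), x ω.1) :=
      Sym2.eq_swap
    have h2 : (shortcutGraph s π M hM).ends (Sum.inr (y ω.1)) = s(y ω.1, π (y ω.1)) := rfl
    exact ((CapGraph.Joins.contract _ F h1).trans (hU ω.1 ω.2)).trans
      (CapGraph.Joins.contract _ F h2)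
  · rintro ⟨e, he⟩
    rw [← NNReal.coe_le_coe, NNReal.coe_sum]
    have hpt : ∀ ω : Ω', ((p ω.1).toNNReal : ℝ) = p ω.1 := fun ω => Real.coe_toNNReal _ (hp _)
    simp only [apply_ite NNReal.toReal, hpt, NNReal.coe_zero]
    rcases e with b | v
    · refine le_trans (le_of_eq ?_) (huse b)
      rw [← hsub _ fun ω h => by simp [h]]
      refine Finset.sum_congr rfl fun ω _ => ?_
      refine if_congr ⟨?_, fun hb => Or.inl (Or.inr ⟨b, hb, rfl⟩)⟩ rfl rfl
      rintro ((h | ⟨b', hb', h⟩) | h)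
      · exact (Sum.inl_ne_inr h).elim
      · exact Sum.inl_injective h ▸ hb'
      · exact (Sum.inl_ne_inr h).elim
    · refine le_trans (Finset.sum_le_sum (g := fun ω : Ω' => (if x ω.1 = v then p ω.1 else 0)
        + (if y ω.1 = v then p ω.1 else 0)) fun ω _ => ?_) ?_
      · have := hp ω.1
        by_cases h1 : x ω.1 = v
        · rw [if_pos (by simp [h1]), if_pos h1]
          split_ifs <;> linarith
        · by_cases h2 : y ω.1 = v
          · rw [if_pos (by simp [h2]), if_neg h1, if_pos h2]
            linarith
          · rw [if_neg (by simp [Ne.symm h1, Ne.symm h2]), if_neg h1, if_neg h2]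
            linarith
      · rw [Finset.sum_add_distrib, hsub (fun ω => if x ω = v then p ω else 0) fun ω h => by
          simp [h], hsub (fun ω => if y ω = v then p ω else 0) fun ω h => by simp [h]]
        have h3 := hx v
        have h4 := hy v
        have h5 : (((shortcutGraph s π M hM).contract F).cap ⟨Sum.inr v, he⟩ : ℝ) = 1 := by
          simp [CapGraph.contract, shortcutGraph]
        rw [h5]
        refine le_trans (add_le_add (le_of_eq_of_le ?_ h3) (le_of_eq_of_le ?_ h4)) (by norm_num)
        · exact Finset.sum_congr rfl fun ω _ => by congr
        · exact Finset.sum_congr rfl fun ω _ => by congr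
  · refine hX.trans ?_
    rw [← hsub _ fun ω h => by simp [h]]
    refine Finset.sum_le_sum fun ω _ => ?_
    rw [Real.coe_toNNReal _ (hp _)]
    refine mul_le_mul_of_nonneg_left ?_ (hp _)
    have h1 := wordDist_triangle s R (x ω.1) (π (x ω.1)) (y ω.1)
    have h2 := wordDist_triangle s R (π (x ω.1)) (π (y ω.1)) (y ω.1)
    have h3 := hπ (x ω.1)
    have h4 := hπ (y ω.1)
    rw [wordDist_comm] at h4
    have h5 : wordDist s R (x ω.1) (y ω.1)
        ≤ wordDist s R (π (x ω.1)) (π (y ω.1)) + 2 * r₀ := by omega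
    have h6 : (wordDist s R (x ω.1) (y ω.1) : ℝ)
        ≤ wordDist s R (π (x ω.1)) (π (y ω.1)) + 2 * r₀ := by exact_mod_cast h5
    simp only [terminalDist, NNReal.coe_natCast]
    linarith

/-- Vertices of one class coincide in the contraction, so routing half of the uniform resampling of
every vertex uses shortcuts only. -/
theorem carriesLength_of_farMass {s : α → V} {π : V → V} {M : ℝ≥0} {hM : 0 < M} {F : Setoid V}
    {R r₀ : ℕ} {T : Finset V} (hπT : ∀ x, π x ∈ T) (hπ : ∀ x, wordDist s R x (π x) ≤ r₀)
    [Fintype (Quotient F)] [DecidableEq (Quotient F)] {ρ : ℝ} {X : ℝ}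
    (hX : X ≤ ρ * farMass s (Quotient.mk F) R ρ / 2 - r₀ * Fintype.card V) :
    ((shortcutGraph s π M hM).contract F).CarriesLength (contractTerminal T F)
      (terminalDist s R T) X := by
  classical
  set cl : V → Quotient F := Quotient.mk F with hcl
  let p : V × V → ℝ := fun q => if cl q.2 = cl q.1 then (classSize cl q.1 : ℝ)⁻¹ / 2 else 0
  have hp0 : ∀ q, 0 ≤ p q := fun q => by
    simp only [p]
    split_ifs <;> positivity
  have hone : ∀ x, ∑ y, p (x, y) = 1 / 2 := by
    intro x
    simp only [p]
    rw [← Finset.sum_filter, Finset.sum_const, nsmul_eq_mul, ← classSize]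
    have : (classSize cl x : ℝ) ≠ 0 := Nat.cast_ne_zero.2 (classSize_pos cl x).ne'
    field_simp
  have hsymm : ∀ x y, p (x, y) = p (y, x) := by
    intro x y
    simp only [p]
    by_cases h : cl y = cl x
    · rw [if_pos h, if_pos h.symm, classSize_congr h]
    · rw [if_neg h, if_neg (Ne.symm h)]
  refine carriesLength_of_family hπT hπ p hp0 Prod.fst Prod.snd (fun _ => ∅) ?_ ?_ ?_ ?_
    (hX.trans ?_)
  · intro q hq
    refine ContractJoins.refl ?_
    by_contra h
    exact hq (if_neg (Ne.symm h))
  · intro v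
    rw [Fintype.sum_prod_type, Finset.sum_eq_single v]
    · simp [hone]
    · intro x _ hx
      simp [hx]
    · simp
  · intro v
    rw [Fintype.sum_prod_type_right, Finset.sum_eq_single v]
    · simp [hsymm _ v, hone]
    · intro x _ hx
      simp [hx]
    · simp
  · simp
  · have h1 : ∀ q : V × V, farKernel s cl R ρ q.1 q.2 * ρ / 2 - p q * (2 * r₀)
        ≤ p q * (wordDist s R q.1 q.2 - 2 * r₀) := by
      intro q
      rw [mul_sub]
      refine sub_le_sub_right ?_ _
      simp only [farKernel, p]
      by_cases hc : cl q.2 = cl q.1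
      · by_cases hd : ρ < wordDist s R q.1 q.2
        · rw [if_pos ⟨hc, hd⟩, if_pos hc, mul_div_right_comm]
          exact mul_le_mul_of_nonneg_left hd.le (by positivity)
        · rw [if_neg (fun h => hd h.2), if_pos hc]
          simp only [zero_mul, zero_div]
          positivity
      · rw [if_neg (fun h => hc h.1), if_neg hc]
        simp
    refine le_trans (le_of_eq ?_) (Finset.sum_le_sum fun q _ => h1 q)
    rw [Finset.sum_sub_distrib, ← Finset.sum_mul, ← Finset.sum_div, ← Finset.sum_mul,
      Fintype.sum_prod_type, Fintype.sum_prod_type]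
    simp only [hone, farMass, Finset.sum_const, Finset.card_univ, nsmul_eq_mul]
    ring

/-- Chains are built on the vertices within `ρ₂` of the centres, where jumps are at most `2 *
⌊ρ₂⌋₊`; `ρ₁` bounds the mean jump from below. A chain has norm at most `R`, so by the girth its norm
is the distance it covers. -/
theorem carriesLength_of_scale [Nonempty V] {s : α → V} {π : V → V} {M : ℝ≥0} {hM : 0 < M}
    {F : Setoid V}
    {R r₀ g : ℕ} {T : Finset V} (hs : GirthAtLeast s g) (hRg : 2 * R ≤ g)
    (hα : 0 < Fintype.card α) (hπT : ∀ x, π x ∈ T)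
    (hπ : ∀ x, wordDist s R x (π x) ≤ r₀) [Fintype (Quotient F)] [DecidableEq (Quotient F)]
    {ρ₁ ρ₂ : ℝ} (hρ₁ : 0 ≤ ρ₁) {n : ℕ} (hD : 2 * ⌊ρ₂⌋₊ < R)
    (hn : (n + 1) * (2 * ⌊ρ₂⌋₊ + 1) ≤ R) (hnM : (n + 1 : ℝ) ≤ 2 * Fintype.card α * M) {X : ℝ}
    (hX : X ≤ n * (ρ₁ * (2 * Fintype.card α * farMass s (Quotient.mk F) R ρ₁
      - 8 * Fintype.card α * farMass s (Quotient.mk F) R ρ₂ - 8 * Fintype.card V)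
      - 2 * R * Fintype.card (Quotient F)) / (4 * Fintype.card α) - r₀ * Fintype.card V) :
    ((shortcutGraph s π M hM).contract F).CarriesLength (contractTerminal T F)
      (terminalDist s R T) X := by
  classical
  set cl : V → Quotient F := Quotient.mk F with hcl
  obtain ⟨ctr, hctr⟩ := exists_centers s cl R ρ₂
  set V₁ : Finset V := Finset.univ.filter fun x => (wordDist s R (ctr (cl x)) x : ℝ) ≤ ρ₂ with hV₁
  have hmem : ∀ x ∈ V₁, wordDist s R (ctr (cl x)) x ≤ ⌊ρ₂⌋₊ := fun x hx =>
    Nat.le_floor (Finset.mem_filter.1 hx).2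
  have hζ : ∀ x, ∃ z : FreeGroup α, x ∈ V₁ → z.norm ≤ ⌊ρ₂⌋₊ ∧
      ctr (cl x) * FreeGroup.lift s z = x := by
    intro x
    by_cases hx : x ∈ V₁
    · obtain ⟨z, hz, h⟩ := exists_of_wordDist_lt (s := s) (R := R) (x := ctr (cl x)) (y := x)
        (by have := hmem x hx; omega)
      exact ⟨z, fun _ => ⟨hz ▸ hmem x hx, h⟩⟩
    · exact ⟨1, fun h => (hx h).elim⟩
  choose ζ hζ using hζ
  have hdiam : ∀ x ∈ V₁, ∀ y ∈ V₁, cl x = cl y → wordDist s R x y ≤ 2 * ⌊ρ₂⌋₊ := by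
    intro x hx y hy hxy
    have h1 := wordDist_triangle s R x (ctr (cl x)) y
    have h2 := hmem x hx
    have h3 := hmem y hy
    rw [wordDist_comm] at h2
    rw [← hxy] at h3
    omega
  set G := goodEdges s cl V₁ (2 * ⌊ρ₂⌋₊) with hG
  have hrev : ∀ e ∈ G, revEdge s e ∈ G := fun e he => revEdge_mem_goodEdges he
  have hgood := le_card_goodEdges hs (by omega : 4 * ⌊ρ₂⌋₊ ≤ g) (fun x hx => (hζ x hx).1)
    fun x hx => (hζ x hx).2
  have hV₁c : ((Fintype.card V - V₁.card : ℕ) : ℝ) ≤ farMass s cl R ρ₂ := by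
    refine le_trans (le_of_eq ?_) hctr
    rw [← Finset.card_compl, hV₁, Finset.compl_filter]
  have hgood' : 2 * Fintype.card α * Fintype.card V - (G.card : ℝ)
      ≤ 4 * Fintype.card α * farMass s cl R ρ₂ + 4 * Fintype.card V := by
    have h1 : (2 * Fintype.card α * Fintype.card V : ℝ) ≤ G.card
      + 4 * Fintype.card α * ((Fintype.card V - V₁.card : ℕ) : ℝ) + 4 * Fintype.card V := by
      exact_mod_cast hgood
    have h2 := mul_le_mul_of_nonneg_left hV₁c
      (show (0 : ℝ) ≤ 4 * Fintype.card α by positivity)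
    linarith
  have hS := le_sum_meanJump s cl R ρ₁ hρ₁ G hrev hα
  obtain ⟨Ω, _, w, fst, lst, z, U, hw, hval, hfst, hlst, huse, -, hnorm⟩ := exists_chain hG hdiam hD
    (Rel := ContractJoins s π M hM F) (fun x y h => ContractJoins.refl h)
    (ContractJoins.edge s π M hM F) ContractJoins.trans n hn
  set r : ℝ := ((Fintype.card α : ℕ) : ℝ) with hr
  have hr0 : 0 < r := Nat.cast_pos.2 hα
  have hcardL : (Fintype.card (α × Bool) : ℝ) = 2 * r := by
    simp [hr, mul_comm]
  have hmarg : ∀ (f : Ω → V × (α × Bool)), (∀ e, ∑ ω, (if f ω = e then w ω else 0) ≤ 1) →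
      ∀ e₀ : V × (α × Bool) → V, Function.Injective (fun e => (e₀ e, e.2)) → ∀ v,
      ∑ ω, (if e₀ (f ω) = v then w ω / (4 * r) else 0) ≤ 1 / 2 := by
    intro f hf e₀ he₀ v
    have h1 : ∑ ω, (if e₀ (f ω) = v then w ω / (4 * r) else 0)
        = (∑ ω, w ω * (if e₀ (f ω) = v then 1 else 0)) / (4 * r) := by
      rw [Finset.sum_div]
      refine Finset.sum_congr rfl fun ω _ => ?_
      split_ifs <;> simp
    rw [h1, sum_mul_comp_eq_sum_fiber w f fun e => if e₀ e = v then 1 else 0,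
      div_le_iff₀ (by positivity)]
    calc _ ≤ ∑ e, if e₀ e = v then (1 : ℝ) else 0 := by
          refine Finset.sum_le_sum fun e _ => ?_
          split_ifs
          · simpa using hf e
          · simp
      _ ≤ Fintype.card (α × Bool) := by
          rw [← Finset.sum_filter, Finset.sum_const, nsmul_eq_mul, mul_one]
          refine Nat.cast_le.2 (Finset.card_le_card_of_injOn (t := Finset.univ) Prod.snd
            (fun _ _ => Finset.mem_coe.2 (Finset.mem_univ _)) fun e he e' he' h => he₀ ?_)
          have h1 := (Finset.mem_filter.1 he).2
          have h2 := (Finset.mem_filter.1 he').2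
          exact Prod.ext (h1.trans h2.symm) h
      _ = _ := by rw [hcardL]; ring
  -- Each vertex is the tail (and the head) of `2 r` directed edges, each of marginal at most one,
  -- so dividing by `4 r` leaves at most 1/2 per end.
  refine carriesLength_of_family hπT hπ (fun ω => w ω / (4 * r)) (fun ω => div_nonneg (hw ω)
    (by positivity)) (fun ω => (fst ω).1) (fun ω => (revEdge s (lst ω)).1) U ?_ ?_ ?_ ?_
    (hX.trans ?_)
  · intro ω h
    have h0 : w ω ≠ 0 := fun h' => h (by simp [h'])
    exact (hval ω h0).2.2.1
  · intro v
    refine le_of_eq_of_le ?_ (hmarg fst hfst Prod.fst (fun _ _ h => h) v)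
    exact Finset.sum_congr rfl fun ω _ => by congr
  · intro v
    refine le_of_eq_of_le ?_ (hmarg lst hlst (fun e => (revEdge s e).1) (fun e e' h => ?_) v)
    · exact Finset.sum_congr rfl fun ω _ => by congr
    · have h1 := congrArg Prod.fst h
      have h2 := congrArg Prod.snd h
      exact (revEdge_involutive s).injective (Prod.ext h1 (congrArg invLetter h2))
  · intro b
    have h1 := huse b
    have h2 : ∑ ω, (if b ∈ U ω then w ω / (4 * r) else 0)
        = (∑ ω, if b ∈ U ω then w ω else 0) / (4 * r) := by
      rw [Finset.sum_div]
      refine Finset.sum_congr rfl fun ω _ => ?_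
      split_ifs <;> simp
    rw [h2, div_le_iff₀ (by positivity)]
    linarith
  · have hdist : ∀ ω, w ω * (z ω).norm ≤ w ω * wordDist s R (fst ω).1 (revEdge s (lst ω)).1 := by
      intro ω
      rcases eq_or_ne (w ω) 0 with h0 | h0
      · simp [h0]
      · obtain ⟨-, -, -, hz, -, hzn⟩ := hval ω h0
        rw [wordDist_eq_norm hs hRg (z ω) (hzn.trans hn) hz]
    have htot : ∑ ω, w ω ≤ 2 * r * Fintype.card V := by
      have h1 := sum_mul_comp_eq_sum_fiber w fst fun _ => 1
      simp only [mul_one] at h1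
      rw [h1]
      refine (Finset.sum_le_sum fun e _ => hfst e).trans (le_of_eq ?_)
      rw [Finset.sum_const, Finset.card_univ, nsmul_eq_mul, Fintype.card_prod, Nat.cast_mul, hcardL]
      ring
    have h2 := Finset.sum_le_sum fun ω (_ : ω ∈ Finset.univ) => hdist ω
    have h3 : ∑ ω, w ω / (4 * r) * ((wordDist s R (fst ω).1 (revEdge s (lst ω)).1 : ℝ) - 2 * r₀)
        = (∑ ω, w ω * (wordDist s R (fst ω).1 (revEdge s (lst ω)).1 : ℝ) - (∑ ω, w ω) * (2 * r₀))
          / (4 * r) := by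
      rw [Finset.sum_mul, ← Finset.sum_sub_distrib, Finset.sum_div]
      exact Finset.sum_congr rfl fun ω _ => by ring
    rw [h3, le_div_iff₀ (by positivity), sub_mul, div_mul_cancel₀ _ (by positivity)]
    have h4 : (∑ ω, w ω) * (2 * r₀) ≤ 2 * r * Fintype.card V * (2 * r₀) :=
      mul_le_mul_of_nonneg_right htot (by positivity)
    have h5 : ρ₁ * (2 * r * farMass s cl R ρ₁ - 8 * r * farMass s cl R ρ₂ - 8 * Fintype.card V)
        ≤ ∑ e ∈ G, meanJump s cl R G e :=
      le_trans (mul_le_mul_of_nonneg_left (by linarith) hρ₁) hS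
    have h6 : (n : ℝ) * (ρ₁ * (2 * r * farMass s cl R ρ₁ - 8 * r * farMass s cl R ρ₂
        - 8 * Fintype.card V) - 2 * R * Fintype.card (Quotient F))
        ≤ n * (∑ e ∈ G, meanJump s cl R G e - 2 * R * Fintype.card (Quotient F)) :=
      mul_le_mul_of_nonneg_left (by linarith) (Nat.cast_nonneg _)
    linarith

end Shortcut

/-! ### Groups of large girth by ping-pong in `SL₂`. -/

section GirthGroup

/-- The centre of the interval attached to a letter. -/
def letterCentre {r : ℕ} (l : Fin r × Bool) : ℤ :=
  6 * (l.1 : ℕ) + if l.2 then 0 else 3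

theorem three_le_abs_sub_letterCentre {r : ℕ} {l l' : Fin r × Bool} (h : l ≠ l') :
    3 ≤ |letterCentre l - letterCentre l'| := by
  obtain ⟨⟨i, hi⟩, b⟩ := l
  obtain ⟨⟨j, hj⟩, c⟩ := l'
  rw [le_abs]
  simp only [letterCentre, ne_eq, Prod.mk.injEq, Fin.mk.injEq, not_and] at h ⊢
  cases b <;> cases c <;> simp_all <;> omega

/-- The action on integer vectors of the matrix attached to a letter, which maps the outside of the
interval of the inverse letter into the interval of the letter. -/
def letterAct {r : ℕ} (l : Fin r × Bool) (p : ℤ × ℤ) : ℤ × ℤ :=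
  if l.2 then
    (letterCentre (l.1, true) * p.1
      - (letterCentre (l.1, true) * letterCentre (l.1, false) + 1) * p.2,
      p.1 - letterCentre (l.1, false) * p.2)
  else
    (-letterCentre (l.1, false) * p.1
      + (letterCentre (l.1, true) * letterCentre (l.1, false) + 1) * p.2,
      -p.1 + letterCentre (l.1, true) * p.2)

/-- The vectors whose slope lies in the interval of a letter. -/
def LetterZone {r : ℕ} (l : Fin r × Bool) (p : ℤ × ℤ) : Prop :=
  |p.1 - letterCentre l * p.2| ≤ |p.2| ∧ p.2 ≠ 0

/-- The zones are slope intervals of radius one around centres at least three apart. -/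
theorem LetterZone.eq {r : ℕ} {l l' : Fin r × Bool} {p : ℤ × ℤ} (h : LetterZone l p)
    (h' : LetterZone l' p) : l = l' := by
  by_contra hne
  have h1 := three_le_abs_sub_letterCentre hne
  have h2 : |(letterCentre l - letterCentre l') * p.2| ≤ 2 * |p.2| := by
    calc |(letterCentre l - letterCentre l') * p.2|
        = |(p.1 - letterCentre l' * p.2) - (p.1 - letterCentre l * p.2)| := by ring_nf
      _ ≤ |p.1 - letterCentre l' * p.2| + |p.1 - letterCentre l * p.2| := abs_sub _ _
      _ ≤ 2 * |p.2| := by linarith [h.1, h'.1]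
  rw [abs_mul] at h2
  have h3 : 0 < |p.2| := abs_pos.2 h.2
  nlinarith

/-- With `c` and `c'` the centres of the letter and of its inverse, the slope `x` goes to `c - 1 /
(x - c')`. -/
theorem letterZone_letterAct {r : ℕ} (l : Fin r × Bool) {p : ℤ × ℤ} (hp : p ≠ 0)
    (h : ¬ LetterZone (invLetter l) p) : LetterZone l (letterAct l p) := by
  obtain ⟨i, b⟩ := l
  obtain ⟨u, v⟩ := p
  have key : ∀ c : ℤ, ¬ (|u - c * v| ≤ |v| ∧ v ≠ 0) → |v| ≤ |u - c * v| ∧ u - c * v ≠ 0 := by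
    intro c hc
    by_cases hv : v = 0
    · subst hv
      have : u ≠ 0 := fun hu => hp (by simp [hu])
      simp [this]
    · have h1 : |v| < |u - c * v| := by
        by_contra! h'
        exact hc ⟨h', hv⟩
      exact ⟨h1.le, fun h0 => by
        rw [h0, abs_zero] at h1
        exact absurd h1 (not_lt.2 (abs_nonneg _))⟩
  cases b
  · obtain ⟨h1, h2⟩ := key (letterCentre (i, true)) h
    simp only [LetterZone, letterAct, Bool.false_eq_true, if_false]
    refine ⟨?_, fun h0 => h2 (by linarith)⟩
    rw [show -letterCentre (i, false) * u + (letterCentre (i, true) * letterCentre (i, false) + 1)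
      * v - letterCentre (i, false) * (-u + letterCentre (i, true) * v) = v by ring,
      show -u + letterCentre (i, true) * v = -(u - letterCentre (i, true) * v) by ring, abs_neg]
    exact h1
  · obtain ⟨h1, h2⟩ := key (letterCentre (i, false)) h
    simp only [LetterZone, letterAct, if_true]
    refine ⟨?_, h2⟩
    rw [show letterCentre (i, true) * u - (letterCentre (i, true) * letterCentre (i, false) + 1)
      * v - letterCentre (i, true) * (u - letterCentre (i, false) * v) = -v by ring, abs_neg]
    exact h1

/-- Ping-pong: the start `(1, 0)` has infinite slope and lies in no zone, and reducedness keeps each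
image outside the zone of the inverse of the next letter. -/
theorem letterZone_foldr {r : ℕ} (l : Fin r × Bool) (w : List (Fin r × Bool))
    (h : FreeGroup.IsReduced (l :: w)) : LetterZone l ((l :: w).foldr letterAct (1, 0)) := by
  induction w generalizing l with
  | nil => exact letterZone_letterAct l (by simp) fun h => h.2 rfl
  | cons l' w ih =>
    obtain ⟨h1, h2⟩ := List.isChain_cons_cons.1 h
    have h3 := ih l' h2
    refine letterZone_letterAct l (fun h0 => h3.2 (by rw [h0]; rfl)) fun h4 => ?_
    have h5 := h4.eq h3
    have h6 := h1 (by rw [← h5]; rfl)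
    rw [← h5] at h6
    simp [invLetter] at h6

theorem abs_letterAct_le {r : ℕ} (l : Fin r × Bool) (p : ℤ × ℤ) (m : ℤ) (h1 : |p.1| ≤ m)
    (h2 : |p.2| ≤ m) : |(letterAct l p).1| ≤ (6 * r + 1) ^ 2 * m ∧
      |(letterAct l p).2| ≤ (6 * r + 1) ^ 2 * m := by
  obtain ⟨⟨i, hi⟩, b⟩ := l
  obtain ⟨u, v⟩ := p
  have hm : 0 ≤ m := (abs_nonneg _).trans h1
  have hi' : (i : ℤ) + 1 ≤ r := by exact_mod_cast hi
  have hi0 : (0 : ℤ) ≤ i := by positivity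
  set x : ℤ := letterCentre ((⟨i, hi⟩ : Fin r), true) with hx
  set y : ℤ := letterCentre ((⟨i, hi⟩ : Fin r), false) with hy
  have hx0 : 0 ≤ x ∧ x ≤ 6 * r := by simp only [hx, letterCentre]; simp; omega
  have hy0 : 0 ≤ y ∧ y ≤ 6 * r := by simp only [hy, letterCentre]; simp; omega
  have hxy : x * y ≤ 36 * r ^ 2 := by nlinarith
  have hxy0 : 0 ≤ x * y := mul_nonneg hx0.1 hy0.1
  have hb : ∀ a b c d : ℤ, |c| ≤ m → |d| ≤ m → 0 ≤ a → 0 ≤ b → a + b ≤ (6 * r + 1) ^ 2 →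
      |a * c| + |b * d| ≤ (6 * r + 1) ^ 2 * m := by
    intro a b c d hc hd ha hb hab
    rw [abs_mul, abs_mul, abs_of_nonneg ha, abs_of_nonneg hb]
    nlinarith [mul_le_mul_of_nonneg_left hc ha, mul_le_mul_of_nonneg_left hd hb]
  cases b
  · simp only [letterAct, Bool.false_eq_true, if_false]
    constructor
    · refine (abs_add_le _ _).trans ?_
      rw [neg_mul, abs_neg]
      exact hb y (x * y + 1) u v h1 h2 hy0.1 (by linarith) (by nlinarith)
    · refine (abs_add_le _ _).trans ?_
      rw [abs_neg, ← one_mul u]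
      exact hb 1 x u v h1 h2 zero_le_one hx0.1 (by nlinarith)
  · simp only [letterAct, if_true]
    constructor
    · refine (abs_sub _ _).trans ?_
      exact hb x (x * y + 1) u v h1 h2 hx0.1 (by linarith) (by nlinarith)
    · refine (abs_sub _ _).trans ?_
      rw [← one_mul u]
      exact hb 1 y u v h1 h2 zero_le_one hy0.1 (by nlinarith)

theorem abs_foldr_letterAct_le {r : ℕ} (w : List (Fin r × Bool)) :
    |(w.foldr letterAct (1, 0)).1| ≤ ((6 * r + 1) ^ 2) ^ w.length ∧
      |(w.foldr letterAct (1, 0)).2| ≤ ((6 * r + 1) ^ 2) ^ w.length := by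
  induction w with
  | nil => simp
  | cons l w ih =>
    rw [List.length_cons, pow_succ' (_ ^ 2 : ℤ)]
    exact abs_letterAct_le l _ _ ih.1 ih.2

open Matrix in
/-- The generators of a subgroup of large girth of `SL₂(ℤ/n)`. -/
def girthGenerator (r n : ℕ) (i : Fin r) : SpecialLinearGroup (Fin 2) (ZMod n) :=
  ⟨!![(letterCentre (i, true) : ZMod n),
      -(letterCentre (i, true) * letterCentre (i, false) + 1 : ZMod n);
      1, -(letterCentre (i, false) : ZMod n)], by
    rw [det_fin_two_of]
    ring⟩

theorem lift_girthGenerator_mulVec (r n : ℕ) (w : List (Fin r × Bool)) :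
    (FreeGroup.lift (girthGenerator r n) (FreeGroup.mk w)).1.mulVec ![1, 0]
      = ![((w.foldr letterAct (1, 0)).1 : ZMod n), ((w.foldr letterAct (1, 0)).2 : ZMod n)] := by
  induction w with
  | nil =>
    rw [← FreeGroup.one_eq_mk]
    simp
  | cons l w ih =>
    rw [← List.singleton_append, ← FreeGroup.mul_mk, map_mul,
      Matrix.SpecialLinearGroup.coe_mul, ← Matrix.mulVec_mulVec, ih, List.singleton_append,
      List.foldr_cons]
    obtain ⟨i, b⟩ := l
    generalize w.foldr letterAct (1, 0) = p
    cases b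
    · have h : FreeGroup.lift (girthGenerator r n) (FreeGroup.mk [(i, false)])
          = (girthGenerator r n i)⁻¹ := by simp [FreeGroup.lift_mk]
      rw [h, Matrix.SpecialLinearGroup.coe_inv, girthGenerator, Matrix.adjugate_fin_two_of]
      ext j
      fin_cases j
      · simp [Matrix.mulVec, dotProduct, Fin.sum_univ_two, letterAct]
      · simp [Matrix.mulVec, dotProduct, Fin.sum_univ_two, letterAct]
    · have h : FreeGroup.lift (girthGenerator r n) (FreeGroup.mk [(i, true)])
          = girthGenerator r n i := by simp [FreeGroup.lift_mk]
      rw [h, girthGenerator]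
      ext j
      fin_cases j
      · simp [Matrix.mulVec, dotProduct, Fin.sum_univ_two, letterAct]
        ring
      · simp [Matrix.mulVec, dotProduct, Fin.sum_univ_two, letterAct]
        ring

/-- Over the integers a nonempty reduced word gives `(1, 0)` a nonzero second coordinate; for short
words it is smaller than `n` in absolute value, hence nonzero modulo `n`. -/
theorem girthAtLeast_girthGenerator (r n g : ℕ) (hn : ((6 * r + 1) ^ 2) ^ g < n) :
    GirthAtLeast (girthGenerator r n) g := by
  intro z hz hlift
  by_contra hne
  rcases hw : z.toWord with _ | ⟨l, w⟩
  · exact hne (FreeGroup.toWord_eq_nil_iff.1 hw)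
  have h1 := lift_girthGenerator_mulVec r n z.toWord
  rw [FreeGroup.mk_toWord, hlift] at h1
  have h2 := congrFun h1 1
  simp only [Matrix.SpecialLinearGroup.coe_one, Matrix.one_mulVec, Matrix.cons_val_one,
    Matrix.cons_val_fin_one] at h2
  have h3 := (ZMod.intCast_zmod_eq_zero_iff_dvd _ _).1 h2.symm
  have h4 := (abs_foldr_letterAct_le z.toWord).2
  have h5 : (((6 * r + 1) ^ 2) ^ z.toWord.length : ℤ) ≤ ((6 * r + 1) ^ 2) ^ g :=
    pow_le_pow_right₀ (one_le_pow₀ (by linarith [Int.natCast_nonneg r])) hz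
  have h6 : (((6 * r + 1) ^ 2) ^ g : ℤ) < n := by exact_mod_cast hn
  have h7 := Int.eq_zero_of_abs_lt_dvd h3 (by linarith)
  have h8 := letterZone_foldr l w (hw ▸ FreeGroup.isReduced_toWord)
  rw [← hw] at h8
  exact h8.2 h7

theorem exists_group_girthAtLeast (r g X : ℕ) (hX : (((6 * r + 1) ^ 2) ^ g + 1) ^ 4 ≤ X) :
    ∃ (V : Type) (_ : Group V) (_ : Fintype V) (s : Fin r → V),
      GirthAtLeast s g ∧ X ≤ Fintype.card V ∧ Fintype.card V ≤ 2 * X := by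
  classical
  set n := ((6 * r + 1) ^ 2) ^ g + 1 with hn
  have : NeZero n := ⟨by omega⟩
  set Γ := Matrix.SpecialLinearGroup (Fin 2) (ZMod n) with hΓ
  have : Fintype Γ := Fintype.ofFinite _
  have hcard : Fintype.card Γ ≤ n ^ 4 := by
    refine (Fintype.card_le_of_injective (fun A : Γ => fun q : Fin 2 × Fin 2 => A.1 q.1 q.2)
      fun A B h => ?_).trans (le_of_eq ?_)
    · ext i j
      exact congrFun h (i, j)
    · simp [ZMod.card]
  have hpos : 0 < Fintype.card Γ := Fintype.card_pos
  -- A cyclic factor, in which the generators are trivial, brings the order between `X` and `2 * X`.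
  set m := X / Fintype.card Γ + 1 with hm
  have : NeZero m := ⟨Nat.succ_ne_zero _⟩
  refine ⟨Γ × Multiplicative (ZMod m), inferInstance, inferInstance,
    fun i => (girthGenerator r n i, 1), ?_, ?_, ?_⟩
  · intro z hz hlift
    refine girthAtLeast_girthGenerator r n g (by omega) z hz ?_
    have h1 : FreeGroup.lift (girthGenerator r n) = (MonoidHom.fst Γ (Multiplicative (ZMod m))).comp
        (FreeGroup.lift fun i => (girthGenerator r n i, (1 : Multiplicative (ZMod m)))) := by
      ext i : 1
      simp
    rw [h1, MonoidHom.comp_apply, hlift, map_one]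
  all_goals
    have h2 : Fintype.card (Multiplicative (ZMod m)) = m := by
      rw [Fintype.card_multiplicative, ZMod.card]
    have h3 := Nat.div_add_mod X (Fintype.card Γ)
    have h4 := Nat.mod_lt X hpos
    rw [Fintype.card_prod, h2, hm, mul_add, mul_one]
    omega

end GirthGroup

/-! ### Nets in groups of large girth. -/

section Net

theorem isReduced_map_true {α : Type} (L : List α) :
    FreeGroup.IsReduced (L.map fun a => (a, true)) := by
  induction L with
  | nil => exact .nil
  | cons a L ih => exact List.isChain_cons.2 ⟨by simp, ih⟩

/-- Positive words of length `m` never cancel and have distinct values. In a maximal family of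
disjoint translates of this set, the translate at any `x` meets one at a net point, which gives
distance at most `2 * m`. -/
theorem exists_net {α V : Type} [DecidableEq α] [Group V] [Fintype α] [Fintype V] {s : α → V}
    {g m : ℕ} (R : ℕ) (hs : GirthAtLeast s g) (hm : 2 * m ≤ g) :
    ∃ T : Finset V, T.card * Fintype.card α ^ m ≤ Fintype.card V ∧
      ∀ x, ∃ t ∈ T, wordDist s R x t ≤ 2 * m := by
  classical
  let word : (Fin m → α) → FreeGroup α := fun f =>
    FreeGroup.mk ((List.ofFn f).map fun a => (a, true))
  have hword : ∀ f, (word f).toWord = (List.ofFn f).map fun a => (a, true) := fun f => by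
    rw [FreeGroup.toWord_mk]
    exact (isReduced_map_true _).reduce_eq
  have hnorm : ∀ f, (word f).norm = m := fun f => by
    simp [FreeGroup.norm, hword]
  have hinj : Function.Injective fun f => FreeGroup.lift s (word f) := by
    intro f f' h
    have h1 : word f = word f' := hs.eq (by rw [hnorm, hnorm]; omega) h
    have h2 : (List.ofFn f).map (fun a => (a, true)) = (List.ofFn f').map fun a => (a, true) := by
      rw [← hword, ← hword, h1]
    exact List.ofFn_injective (List.map_injective_iff.2 (fun a b h => congrArg Prod.fst h) h2)
  let B : V → Finset V := fun t => Finset.univ.image fun f => t * FreeGroup.lift s (word f)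
  have hB : ∀ t, (B t).card = Fintype.card α ^ m := fun t => by
    rw [Finset.card_image_of_injective _ fun f f' h => hinj (mul_left_cancel h)]
    simp
  obtain ⟨T, hT, hmax⟩ := Finset.exists_max_image
    (Finset.univ.filter fun T : Finset V => (T : Set V).PairwiseDisjoint B) Finset.card
    ⟨∅, by simp⟩
  have hT := (Finset.mem_filter.1 hT).2
  refine ⟨T, ?_, fun x => ?_⟩
  · rw [← Finset.sum_const_nat fun t _ => hB t, ← Finset.card_biUnion hT]
    exact Finset.card_le_univ _
  · by_contra! hfar
    have hx : x ∉ T := fun h => by simpa using hfar x h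
    have hdisj : ∀ t ∈ T, Disjoint (B x) (B t) := by
      intro t ht
      rw [Finset.disjoint_left]
      intro y h1 h2
      obtain ⟨f, -, rfl⟩ := Finset.mem_image.1 h1
      obtain ⟨f', -, h2⟩ := Finset.mem_image.1 h2
      refine (hfar t ht).not_ge ((wordDist_le_norm (word f * (word f')⁻¹) ?_).trans
        ((FreeGroup.norm_mul_le _ _).trans ?_))
      · rw [map_mul, ← mul_assoc, ← h2]
        simp
      · rw [FreeGroup.norm_inv_eq, hnorm, hnorm]
        omega
    have h1 := hmax (insert x T) (Finset.mem_filter.2 ⟨Finset.mem_univ _, by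
      rw [Finset.coe_insert]
      exact hT.insert fun t ht _ => hdisj t ht⟩)
    rw [Finset.card_insert_of_notMem hx] at h1
    omega

end Net

/-! ### Combination of the scales, choice of parameters, and conclusion. -/

theorem carriesLength_of_scales {V : Type} [Group V] [Fintype V] {I r : ℕ} (hr : r = 16 ^ (I + 2))
    {s : Fin r → V} {π : V → V} {M : ℝ≥0} {hM : 0 < M} {F : Setoid V} {R r₀ g : ℕ} {T : Finset V}
    (hs : GirthAtLeast s g) (hRg : 2 * R ≤ g) (hπT : ∀ x, π x ∈ T)
    (hπ : ∀ x, wordDist s R x (π x) ≤ r₀) (ρ : ℕ → ℝ) (B : ℝ)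
    (hρ1 : ∀ i ≤ I, 1 ≤ ρ i) (hρR : ∀ i ≤ I, 12 * ρ i ≤ R) (hB : ∀ i < I, ρ (i + 1) ≤ B * ρ i)
    (hball : 2 * (partitionSize F * (2 * r + 1 : ℝ) ^ ⌊ρ 0⌋₊) ≤ Fintype.card V)
    (hR : (R * partitionSize F : ℝ) ≤ Fintype.card V) (hMR : ∀ i ≤ I, (R : ℝ) ≤ M * ρ i) {X : ℝ}
    (hX₁ : X ≤ Fintype.card V * (ρ I / (4 * 16 ^ I) - r₀))
    (hX₂ : X ≤ Fintype.card V * (R / (96 * 16 ^ I * B) - r₀)) :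
    ((shortcutGraph s π M hM).contract F).CarriesLength (contractTerminal T F)
      (terminalDist s R T) X := by
  classical
  have : Fintype (Quotient F) := Fintype.ofFinite _
  rw [partitionSize, Nat.card_eq_fintype_card] at hball hR
  set N : ℝ := ((Fintype.card V : ℕ) : ℝ) with hN
  set Ψ : ℕ → ℝ := fun i => farMass s (Quotient.mk F) R (ρ i) with hΨ
  have hN0 : 0 < N := Nat.cast_pos.2 Fintype.card_pos
  have h0 : N / 2 ≤ Ψ 0 := by
    have h1 := le_farMass s (Quotient.mk F) R (ρ 0) (by linarith [hρ1 0 (by omega)])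
      (by linarith [hρ1 0 (by omega), hρR 0 (by omega)])
    rw [Fintype.card_fin] at h1
    simp only [hΨ]
    linarith
  have hI : (1 : ℝ) ≤ 16 ^ I := one_le_pow₀ (by norm_num)
  rcases exists_scale Ψ (N / 2) h0 I with h | ⟨i, hi, h1, h2⟩
  · refine carriesLength_of_farMass hπT hπ (ρ := ρ I) (hX₁.trans ?_)
    have h1 : 1 ≤ ρ I := hρ1 I le_rfl
    have h2 := mul_le_mul_of_nonneg_left h (show (0 : ℝ) ≤ ρ I by linarith)
    have h3 : N * (ρ I / (4 * 16 ^ I) - r₀) = ρ I * (N / 2 / 16 ^ I) / 2 - r₀ * N := by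
      field_simp
      ring
    rw [h3]
    simp only [hΨ] at h2
    linarith
  · have hx1 := hρ1 i hi.le
    have hy1 := hρ1 (i + 1) hi
    have hyR := hρR (i + 1) hi
    have hBi := hB i hi
    have hMi := hMR (i + 1) hi
    set x := ρ i with hx
    set y := ρ (i + 1) with hy
    set D := 2 * ⌊y⌋₊ with hD
    have hfl : (⌊y⌋₊ : ℝ) ≤ y := Nat.floor_le (by linarith)
    have hfl' : y < ⌊y⌋₊ + 1 := Nat.lt_floor_add_one y
    have hfl1 : 1 ≤ ⌊y⌋₊ := Nat.le_floor (by simpa using hy1)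
    have hfl1' : (1 : ℝ) ≤ ⌊y⌋₊ := by exact_mod_cast hfl1
    have hDy : (D : ℝ) + 1 ≤ 3 * y := by
      rw [hD]
      push_cast
      linarith
    have hyD : y ≤ (D : ℝ) + 1 := by
      rw [hD]
      push_cast
      linarith
    have hBpos : 0 < B := by
      by_contra! hneg
      nlinarith
    have hdiv : ((R / (D + 1) : ℕ) : ℝ) + 1 ≥ R / (D + 1) := by
      have := Nat.lt_floor_add_one ((R : ℝ) / ((D + 1 : ℕ) : ℝ))
      rw [Nat.floor_div_eq_div] at this
      push_cast at this
      exact this.le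
    have hdiv' : ((R / (D + 1) : ℕ) : ℝ) ≤ R / (D + 1) := by
      have := Nat.cast_div_le (α := ℝ) (m := R) (n := D + 1)
      push_cast at this
      exact this
    have hRD : (R : ℝ) / (3 * y) ≤ R / (D + 1) :=
      div_le_div_of_nonneg_left (by positivity) (by positivity) hDy
    have h4 : 4 ≤ (R : ℝ) / (3 * y) := by
      rw [le_div_iff₀ (by positivity)]
      linarith
    -- Chains have as many edges as fit into length `R`; one less is the number of jumps.
    obtain ⟨n, hn⟩ : ∃ n, R / (D + 1) = n + 1 := by
      refine ⟨R / (D + 1) - 1, ?_⟩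
      have : (1 : ℝ) ≤ ((R / (D + 1) : ℕ) : ℝ) := by linarith
      have : 1 ≤ R / (D + 1) := by exact_mod_cast this
      omega
    rw [hn] at hdiv hdiv'
    push_cast at hdiv hdiv'
    have hnR : (R : ℝ) / (6 * y) ≤ n := by
      have : (R : ℝ) / (6 * y) = R / (3 * y) / 2 := by
        field_simp
        ring
      linarith
    have hrpos : (1 : ℝ) ≤ r := by
      rw [hr]
      push_cast
      exact one_le_pow₀ (by norm_num)
    refine carriesLength_of_scale hs hRg (by simp [hr]) hπT hπ (ρ₁ := x) (ρ₂ := y)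
      (by linarith) (n := n) ?_ ?_ ?_ (hX₂.trans ?_)
    · have : (D : ℝ) < R := by linarith
      exact_mod_cast this
    · rw [← hn]
      exact Nat.div_mul_le_self _ _
    · rw [Fintype.card_fin]
      have h5 : (R : ℝ) / (D + 1) ≤ M := by
        rw [div_le_iff₀ (by positivity)]
        exact hMi.trans (mul_le_mul_of_nonneg_left hyD M.2)
      have h6 : (M : ℝ) ≤ 2 * r * M := le_mul_of_one_le_left M.2 (by linarith)
      linarith
    · rw [Fintype.card_fin]
      have hΨx : N / (2 * 16 ^ I) ≤ Ψ i := by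
        refine le_trans ?_ h2
        rw [div_div]
        refine div_le_div_of_nonneg_left hN0.le (by positivity) ?_
        exact mul_le_mul_of_nonneg_left (pow_le_pow_right₀ (by norm_num) hi.le) (by norm_num)
      -- The degree `16 ^ (I + 2)` is chosen so that the far mass, even after `I` drops, outweighs
      -- the `8 * N` lost to occupied directions.
      have hrΨ : 128 * N ≤ r * Ψ i := by
        calc 128 * N = r * (N / (2 * 16 ^ I)) := by
              rw [hr]
              push_cast
              rw [pow_add]
              field_simp
              norm_num
          _ ≤ _ := mul_le_mul_of_nonneg_left hΨx (by positivity)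
      have h5 : x * (r * Ψ i) ≤ x * (2 * r * Ψ i - 8 * r * Ψ (i + 1) - 8 * N) := by
        refine mul_le_mul_of_nonneg_left ?_ (by linarith)
        have := mul_le_mul_of_nonneg_left h1 (show (0 : ℝ) ≤ 8 * r by positivity)
        linarith
      have h6 : 2 * (R : ℝ) * Fintype.card (Quotient F) ≤ x * (r * Ψ i) / 2 := by
        have : 1 * (r * Ψ i) ≤ x * (r * Ψ i) :=
          mul_le_mul_of_nonneg_right hx1 (by linarith)
        linarith
      have h7 : (R : ℝ) / (6 * y) * (x * (r * (N / (2 * 16 ^ I))) / 2)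
          ≤ n * (x * (2 * r * Ψ i - 8 * r * Ψ (i + 1) - 8 * N)
            - 2 * R * Fintype.card (Quotient F)) := by
        refine mul_le_mul hnR ?_ (by positivity) (Nat.cast_nonneg _)
        have := mul_le_mul_of_nonneg_left (mul_le_mul_of_nonneg_left hΨx
          (show (0 : ℝ) ≤ r by positivity)) (show (0 : ℝ) ≤ x by linarith)
        linarith
      have h8 : N * (R / (96 * 16 ^ I * B)) ≤
          (R : ℝ) / (6 * y) * (x * (r * (N / (2 * 16 ^ I))) / 2) / (4 * r) := by
        have h9 : (R : ℝ) / (6 * y) * (x * (r * (N / (2 * 16 ^ I))) / 2) / (4 * r)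
            = N * (R / (96 * 16 ^ I * (y / x))) := by
          field_simp
          ring
        rw [h9]
        refine mul_le_mul_of_nonneg_left ?_ hN0.le
        refine div_le_div_of_nonneg_left (Nat.cast_nonneg _) (by positivity) ?_
        refine mul_le_mul_of_nonneg_left ?_ (by positivity)
        rw [div_le_iff₀ (by linarith)]
        exact hBi
      have h9 := div_le_div_of_nonneg_right h7 (show (0 : ℝ) ≤ 4 * r by positivity)
      rw [mul_sub, mul_comm N (r₀ : ℝ)]
      exact sub_le_sub_right (h8.trans h9) _

/-- Nothing else about `cZero` is needed. -/
theorem cZero_bounds : 1 / 4 ≤ cZero ∧ cZero ≤ 1 / 3 := by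
  have h1 : 2 ≤ Real.logb 2 5 := by
    rw [Real.le_logb_iff_rpow_le (by norm_num) (by norm_num)]
    norm_num
  have h2 : Real.logb 2 5 ≤ 3 := by
    rw [Real.logb_le_iff_le_rpow (by norm_num) (by norm_num)]
    norm_num
  rw [cZero]
  constructor
  · exact div_le_div_of_nonneg_left (by norm_num) (by linarith) (by linarith)
  · exact div_le_div_of_nonneg_left (by norm_num) (by linarith) (by linarith)

theorem contraction_and_mixture_bound {V E : Type} [Fintype V] [Fintype E] (G : CapGraph V E)
    (T : Finset V) (dist : T → T → ℝ≥0) (hsymm : ∀ t t', dist t t' = dist t' t) (len : E → ℝ≥0)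
    (hd : ∀ (t t' : T) (P : G.Path t.1 t'.1), dist t t' ≤ (P.1.edges.map len).sum)
    {Q B : ℝ} (hpos : 0 < ∑ e, (G.cap e : ℝ) * len e)
    (h : ∀ F : Setoid V, (partitionSize F : ℝ) ≤ B →
      (G.contract F).CarriesLength (contractTerminal T F) dist
        (Q * ∑ e, (G.cap e : ℝ) * len e)) :
    (∀ F : Setoid V, ValidPartition T F → (partitionSize F : ℝ) ≤ B → ∀ q : ℝ,
      G.IsFlowSparsifier (fun t : T => t.1) (G.contract F) (contractTerminal T F) q → Q ≤ q) ∧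
    (∀ μ : PMF {F : Setoid V // ValidPartition T F},
      (∀ F ∈ μ.support, (partitionSize F.1 : ℝ) ≤ B) → ∀ q : ℝ,
      G.IsFlowSparsifier (fun t : T => t.1) (mixtureGraph G T μ) (mixtureTerminal T μ) q →
      Q ≤ q) := by
  classical
  refine ⟨fun F _ hF q hq => le_of_mul_le_mul_right
    ((h F hF).le_of_isFlowSparsifier hsymm hd hq) hpos, fun μ hμ q hq => ?_⟩
  have : Finite (Setoid V) := Finite.of_injective (fun F : Setoid V => F.r)
    fun F F' h => Setoid.ext fun a b => iff_of_eq (congrFun (congrFun h a) b)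
  have : Fintype {F : Setoid V // ValidPartition T F} := Fintype.ofFinite _
  have : Fintype μ.support := Fintype.ofFinite _
  have hsum : ∑ F : μ.support, (μ F.1).toNNReal = 1 := by
    have h1 := μ.tsum_coe
    rw [← tsum_subtype_eq_of_support_subset (s := μ.support) (f := μ) (fun _ h => h),
      tsum_fintype] at h1
    rw [← ENNReal.coe_inj, ENNReal.ofNNReal_finsetSum, ENNReal.coe_one, ← h1]
    exact Finset.sum_congr rfl fun F _ => ENNReal.coe_toNNReal (μ.apply_ne_top F.1)
  have hmix := CapGraph.CarriesLength.glue (ι := μ.support) (fun F => G.contract F.1.1)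
    (fun F => contractTerminal T F.1.1) (fun F => (μ F.1).toNNReal)
    (fun F => ENNReal.toNNReal_pos ((μ.mem_support_iff F.1).1 F.2) (μ.apply_ne_top F.1)) hsum dist
    (Q * ∑ e, (G.cap e : ℝ) * len e) fun F => h F.1.1 (hμ F.1 F.2)
  exact le_of_mul_le_mul_right (CapGraph.CarriesLength.le_of_isFlowSparsifier hsymm hd hmix hq) hpos

/-- Cayley graphs of large girth with shortcuts to a net of `k` terminals. -/
theorem exists_group_and_terminals {r R k A : ℕ} (hr : 2 ≤ r)
    (hgirth : (((6 * r + 1) ^ 2) ^ (2 * R) + 1) ^ 4 ≤ k) (hA : A + 1 ≤ R) :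
    ∃ (V : Type) (_ : Group V) (_ : Fintype V) (s : Fin r → V) (T : Finset V) (π : V → V),
      GirthAtLeast s (2 * R) ∧ k * 2 ^ A ≤ Fintype.card V ∧ T.card = k ∧ (∀ x, π x ∈ T) ∧
      ∀ x, wordDist s R x (π x) ≤ 2 * (A + 1) := by
  classical
  obtain ⟨V, _, _, s, hs, hN, hN'⟩ := exists_group_girthAtLeast r (2 * R) (k * 2 ^ A)
    (hgirth.trans (Nat.le_mul_of_pos_right _ (by positivity)))
  -- Translates of size at least `2 ^ (A + 1)` in a group of order at most `2 * (k * 2 ^ A)`: at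
  -- most `k` of them are disjoint. Enlarging the net to `k` points keeps it a net.
  obtain ⟨T₀, hT₀, hnet⟩ := exists_net R hs (m := A + 1) (by omega)
  have hcard : T₀.card ≤ k := by
    rw [Fintype.card_fin] at hT₀
    have h1 : T₀.card * 2 ^ (A + 1) ≤ k * 2 ^ (A + 1) := by
      calc T₀.card * 2 ^ (A + 1) ≤ T₀.card * r ^ (A + 1) :=
            Nat.mul_le_mul_left _ (Nat.pow_le_pow_left hr _)
        _ ≤ Fintype.card V := hT₀
        _ ≤ 2 * (k * 2 ^ A) := hN'
        _ = k * 2 ^ (A + 1) := by ring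
    exact Nat.le_of_mul_le_mul_right h1 (by positivity)
  obtain ⟨T, hT, hTk⟩ := Finset.exists_superset_card_eq hcard
    ((Nat.le_mul_of_pos_right _ (by positivity)).trans hN)
  choose π hπ hπd using hnet
  exact ⟨V, _, _, s, T, π, hs, hN, hTk, fun x => hT (hπ x), hπd⟩

theorem girth_bound {I R k r : ℕ} (hr : r = 16 ^ (I + 2))
    (h : (2 : ℝ) ^ ((32 * I + 100) * (2 * R + 1)) ≤ k) :
    (((6 * r + 1) ^ 2) ^ (2 * R) + 1) ^ 4 ≤ k := by
  have h1 : 6 * r + 1 ≤ 2 ^ (4 * I + 12) := by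
    have : (16 : ℕ) ^ (I + 2) = 2 ^ (4 * I + 8) := by
      rw [show (16 : ℕ) = 2 ^ 4 by norm_num, ← pow_mul]
      ring_nf
    rw [hr, this, show 4 * I + 12 = (4 * I + 8) + 4 by ring, pow_add 2 (4 * I + 8) 4]
    have : 1 ≤ 2 ^ (4 * I + 8) := Nat.one_le_two_pow
    omega
  have h2 : ((6 * r + 1) ^ 2) ^ (2 * R) + 1 ≤ 2 ^ ((4 * I + 12) * 2 * (2 * R) + 1) := by
    calc ((6 * r + 1) ^ 2) ^ (2 * R) + 1
        ≤ ((2 ^ (4 * I + 12)) ^ 2) ^ (2 * R) + 1 := by gcongr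
      _ = 2 ^ ((4 * I + 12) * 2 * (2 * R)) + 1 := by rw [← pow_mul, ← pow_mul, mul_assoc]
      _ ≤ _ := by
        rw [pow_succ]
        have : 1 ≤ 2 ^ ((4 * I + 12) * 2 * (2 * R)) := Nat.one_le_two_pow
        omega
  calc _ ≤ (2 ^ ((4 * I + 12) * 2 * (2 * R) + 1)) ^ 4 := Nat.pow_le_pow_left h2 4
    _ = 2 ^ (((4 * I + 12) * 2 * (2 * R) + 1) * 4) := by rw [← pow_mul]
    _ ≤ 2 ^ ((32 * I + 100) * (2 * R + 1)) := by
        refine Nat.pow_le_pow_right (by norm_num) ?_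
        ring_nf
        omega
    _ ≤ k := by exact_mod_cast h

theorem le_two_rpow {L a : ℝ} (ha : 48 ≤ a) (hL : L ≤ a ^ 2) : L ≤ 2 ^ a := by
  -- The cubic Taylor term suffices: `(a / 2) ^ 3 / 6 = a ^ 3 / 48 ≥ a ^ 2`.
  have h1 := Real.pow_div_factorial_le_exp (a * Real.log 2)
    (mul_nonneg (by linarith) (Real.log_nonneg (by norm_num))) 3
  have h2 : (2 : ℝ) ^ a = Real.exp (a * Real.log 2) := by
    rw [Real.rpow_def_of_pos (by norm_num), mul_comm]
  have h3 : 1 / 2 ≤ Real.log 2 := by linarith [Real.log_two_gt_d9]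
  have h4 : a * (1 / 2) ≤ a * Real.log 2 := mul_le_mul_of_nonneg_left h3 (by linarith)
  have h5 : (a * (1 / 2)) ^ 3 ≤ (a * Real.log 2) ^ 3 := pow_le_pow_left₀ (by linarith) h4 3
  have h6 : ((3).factorial : ℝ) = 6 := by norm_num [Nat.factorial]
  rw [h6] at h1
  rw [h2]
  nlinarith [sq_nonneg a]

/-- The threshold for `(log k) ^ ε` above which the construction works. -/
noncomputable def scaleThreshold (I : ℕ) : ℝ :=
  1536 * (32 * I + 100) * 16 ^ I * (2 * 16 ^ (I + 2) + 2 * (4 * I + 14))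

set_option maxHeartbeats 2000000 in
theorem exists_hard_graph {ε : ℝ} (hε : 0 < ε) (hε' : ε < 1 / 16) {I : ℕ} (hI : 1 / ε ≤ I) {k : ℕ}
    {L : ℝ} (hL : L = Real.logb 2 k) (hL1 : 1 ≤ L) (hK : scaleThreshold I ≤ L ^ ε) :
    ∃ (V E : Type) (_ : Fintype V) (_ : Fintype E) (G : CapGraph V E) (T : Finset V)
      (dist : T → T → ℝ≥0) (len : E → ℝ≥0),
      (∀ e, 1 ≤ G.cap e) ∧ T.card = k ∧ (∀ t t', dist t t' = dist t' t) ∧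
      (∀ (t t' : T) (P : G.Path t.1 t'.1), dist t t' ≤ (P.1.edges.map len).sum) ∧
      0 < ∑ e, (G.cap e : ℝ) * len e ∧
      ∀ F : Setoid V, (partitionSize F : ℝ) ≤ sizeBound k ε →
        (G.contract F).CarriesLength (contractTerminal T F) dist
          (L ^ (cZero - 3 * ε) * ∑ e, (G.cap e : ℝ) * len e) := by
  obtain ⟨hc1, hc2⟩ := cZero_bounds
  have hL0 : 0 < L := by linarith
  have hk0 : 0 < k := by
    rcases Nat.eq_zero_or_pos k with rfl | h
    · simp [hL] at hL1
      linarith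
    · exact h
  have hk : (k : ℝ) = 2 ^ L := by
    rw [hL, Real.rpow_logb (by norm_num) (by norm_num) (by exact_mod_cast hk0)]
  have hI0 : (0 : ℝ) < I := lt_of_lt_of_le (by positivity) hI
  have h16 : (1 : ℝ) ≤ 16 ^ I := one_le_pow₀ (by norm_num)
  set a : ℝ := L ^ ((1 - cZero) + ε) with ha
  set c : ℝ := 32 * I + 100 with hc
  set C₂ : ℝ := 2 * 16 ^ (I + 2) + 2 * (4 * I + 14) with hC₂
  have hc100 : 100 ≤ c := by linarith
  have hC₂28 : 28 ≤ C₂ := by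
    have : (0 : ℝ) ≤ 16 ^ (I + 2) := by positivity
    linarith
  have hC₂b : 2 * (4 * (I : ℝ) + 14) ≤ C₂ := by
    have : (0 : ℝ) ≤ 16 ^ (I + 2) := by positivity
    linarith
  have hK' : 1536 * c * 16 ^ I * C₂ ≤ L ^ ε := hK
  have hKc : 768 * c * C₂ ≤ L ^ ε := by
    refine le_trans ?_ hK'
    have h1 : c * C₂ * 1 ≤ c * C₂ * 16 ^ I := mul_le_mul_of_nonneg_left h16 (by positivity)
    have h2 : 0 < c * C₂ := by positivity
    linarith
  have hcC₂ : c * 28 ≤ c * C₂ := mul_le_mul_of_nonneg_left hC₂28 (by linarith)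
  have hmono : ∀ {x y : ℝ}, x ≤ y → L ^ x ≤ L ^ y := fun h => Real.rpow_le_rpow_of_exponent_le hL1 h
  have haε : L ^ ε ≤ a := hmono (by linarith)
  have ha48 : 48 ≤ a := by linarith
  have haL : L ≤ a ^ 2 := by
    rw [ha, ← Real.rpow_natCast, ← Real.rpow_mul hL0.le]
    calc L = L ^ (1 : ℝ) := (Real.rpow_one L).symm
      _ ≤ _ := hmono (by push_cast; linarith)
  have hL2a : L ≤ 2 ^ a := le_two_rpow ha48 haL
  have ha1 : a ≤ L ^ (1 - ε) := hmono (by linarith)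
  have hsplit : L ^ (1 - ε) * L ^ ε = L := by
    rw [← Real.rpow_add hL0]
    simp
  have hL1ε : 0 < L ^ (1 - ε) := Real.rpow_pos_of_pos hL0 _
  -- In the exponent, `a` pays for the number of classes, `(4 * I + 10) * a` for a ball of radius
  -- `a`, and another `a` for the factor 2.
  set A : ℕ := ⌈(4 * I + 12) * a⌉₊ with hA
  have hAge : (4 * I + 12) * a ≤ A := Nat.le_ceil _
  have hAle : (A : ℝ) + 1 ≤ (4 * I + 14) * a := by
    have : (A : ℝ) < (4 * I + 12) * a + 1 := Nat.ceil_lt_add_one (by positivity)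
    linarith
  set R : ℕ := ⌊L / (4 * c)⌋₊ with hR
  have hRle : (R : ℝ) ≤ L / (4 * c) := Nat.floor_le (by positivity)
  have hLc : 8 * c ≤ L := by
    have : L ^ ε ≤ L := by
      calc L ^ ε ≤ L ^ (1 : ℝ) := hmono (by linarith)
        _ = L := Real.rpow_one L
    linarith
  have hRge : L / (8 * c) ≤ R := by
    have h1 : L / (4 * c) < R + 1 := Nat.lt_floor_add_one _
    have h2 : L / (4 * c) = 2 * (L / (8 * c)) := by
      field_simp
      norm_num
    have h3 : 1 ≤ L / (8 * c) := by
      rw [le_div_iff₀ (by positivity)]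
      linarith
    linarith
  have hRL : (R : ℝ) ≤ L := hRle.trans (div_le_self hL0.le (by linarith))
  have hRbig : ∀ t, t * (8 * c) ≤ L ^ ε → t * L ^ (1 - ε) ≤ R := by
    intro t ht
    refine le_trans ?_ hRge
    rw [le_div_iff₀ (by positivity)]
    calc t * L ^ (1 - ε) * (8 * c) = L ^ (1 - ε) * (t * (8 * c)) := by ring
      _ ≤ L ^ (1 - ε) * L ^ ε := mul_le_mul_of_nonneg_left ht hL1ε.le
      _ = L := hsplit
  have hAR : A + 1 ≤ R := by
    have h1 : (A : ℝ) + 1 ≤ R := by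
      refine hAle.trans ((mul_le_mul_of_nonneg_left ha1 (by positivity)).trans (hRbig _ ?_))
      have h2 := mul_le_mul_of_nonneg_left hC₂b (show 0 ≤ c by linarith)
      linarith
    exact_mod_cast h1
  have hgirth : (2 : ℝ) ^ ((32 * I + 100) * (2 * R + 1)) ≤ k := by
    rw [hk, ← Real.rpow_natCast]
    refine Real.rpow_le_rpow_of_exponent_le (by norm_num) ?_
    push_cast
    rw [le_div_iff₀ (by positivity)] at hRle
    rw [← hc]
    linarith
  obtain ⟨r, hr⟩ : ∃ r, r = 16 ^ (I + 2) := ⟨_, rfl⟩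
  have hrR : (r : ℝ) = 16 ^ (I + 2) := by
    rw [hr]
    push_cast
    rfl
  have hr2 : 2 ≤ r := by
    rw [hr]
    exact le_trans (by norm_num) (Nat.pow_le_pow_right (by norm_num) (by omega : 1 ≤ I + 2))
  obtain ⟨V, _, _, s, T, π, hs, hN, hTk, hπT, hπ⟩ :=
    exists_group_and_terminals (A := A) hr2 (girth_bound hr hgirth) hAR
  obtain ⟨N, hNdef⟩ : ∃ N : ℝ, N = ((Fintype.card V : ℕ) : ℝ) := ⟨_, rfl⟩
  have hN' : k * (2 : ℝ) ^ ((4 * I + 12) * a) ≤ N := by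
    calc (k : ℝ) * (2 : ℝ) ^ ((4 * I + 12) * a) ≤ k * 2 ^ A := by
          rw [← Real.rpow_natCast 2 A]
          exact mul_le_mul_of_nonneg_left
            (Real.rpow_le_rpow_of_exponent_le (by norm_num) hAge) (Nat.cast_nonneg _)
      _ ≤ N := by rw [hNdef]; exact_mod_cast hN
  have hN0 : 0 < N := lt_of_lt_of_le (by positivity) hN'
  have hM1 : (1 : ℝ≥0) ≤ (⌈L / a⌉₊ : ℝ≥0) := by
    have : 0 < ⌈L / a⌉₊ := Nat.ceil_pos.2 (by positivity)
    exact_mod_cast this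
  -- Large enough for chains of `R / ρ i` edges at every scale, as `ρ i ≥ a`; since `cZero ≤ 1 / 2`,
  -- still at most `2 * a`, comparable to the shortcut length.
  set M : ℝ≥0 := (⌈L / a⌉₊ : ℝ≥0) with hM
  have hMge : L / a ≤ M := by
    rw [hM, NNReal.coe_natCast]
    exact Nat.le_ceil _
  have hMle : (M : ℝ) ≤ 2 * a := by
    have h1 : (M : ℝ) < L / a + 1 := by
      rw [hM, NNReal.coe_natCast]
      exact Nat.ceil_lt_add_one (by positivity)
    have h2 : L / a ≤ a := by
      rw [div_le_iff₀ (by positivity), ← sq]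
      exact haL
    linarith
  have hM0 : 0 < M := lt_of_lt_of_le zero_lt_one hM1
  have hvol := sum_cap_mul_shortcutLength s π M hM0 (2 * (A + 1))
  rw [Fintype.card_fin, ← hNdef] at hvol
  have hcost : ((r : ℝ) * M + ((2 * (A + 1) : ℕ) : ℝ)) ≤ C₂ * a := by
    have h1 := mul_le_mul_of_nonneg_left hMle (show (0 : ℝ) ≤ 16 ^ (I + 2) by positivity)
    rw [hrR]
    push_cast
    rw [hC₂]
    linarith
  refine ⟨V, (V × Fin r) ⊕ V, inferInstance, inferInstance, shortcutGraph s π M hM0, T,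
    terminalDist s R T, shortcutLength (2 * (A + 1)), ?_, hTk, ?_, ?_, ?_, ?_⟩
  · rintro (e | e)
    · exact hM1
    · exact le_rfl
  · intro t t'
    rw [terminalDist, terminalDist, wordDist_comm]
  · intro t t' P
    exact wordDist_le_sum_edges hπ P.1
  · rw [hvol]
    have : 0 < ((2 * (A + 1) : ℕ) : ℝ) := by positivity
    positivity
  · intro F hF
    have hF' : (partitionSize F : ℝ) ≤ k * (2 : ℝ) ^ a := by
      rw [sizeBound, ← hL] at hF
      exact hF
    -- The scales rise from `a` to `L ^ (1 - ε)` in `I ≥ 1 / ε` equal steps of the exponent, so each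
    -- ratio is at most `L ^ ε`.
    set θ : ℝ := (cZero - 2 * ε) / I with hθ
    have hθ0 : 0 ≤ θ := div_nonneg (by linarith) hI0.le
    have hIθ : I * θ = cZero - 2 * ε := by
      rw [hθ]
      field_simp
    have hθε : θ ≤ ε := by
      rw [hθ, div_le_iff₀ hI0]
      have := mul_le_mul_of_nonneg_left hI hε.le
      rw [mul_one_div_cancel hε.ne'] at this
      linarith
    set ρ : ℕ → ℝ := fun i => L ^ ((1 - cZero) + ε + i * θ) with hρ
    have hρ0 : ρ 0 = a := by simp [hρ, ha]
    have hρa : ∀ i, a ≤ ρ i := fun i => hmono (by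
      have : 0 ≤ (i : ℝ) * θ := by positivity
      linarith)
    have hρle : ∀ i ≤ I, ρ i ≤ L ^ (1 - ε) := fun i hi => hmono (by
      have : (i : ℝ) * θ ≤ I * θ := mul_le_mul_of_nonneg_right (Nat.cast_le.2 hi) hθ0
      linarith)
    have hρI : ρ I = L ^ (1 - ε) := by
      simp only [hρ, hIθ]
      congr 1
      ring
    set Z : ℝ := L ^ (1 - 2 * ε) with hZ
    have hZa : a ≤ Z := hmono (by linarith)
    have hZε : Z * L ^ ε = L ^ (1 - ε) := by
      rw [hZ, ← Real.rpow_add hL0]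
      congr 1
      ring
    have hQa : L ^ (cZero - 3 * ε) * a = Z := by
      rw [hZ, ha, ← Real.rpow_add hL0]
      congr 1
      ring
    have hZ0 : 0 < Z := Real.rpow_pos_of_pos hL0 _
    have hQ0 : 0 ≤ L ^ (cZero - 3 * ε) := Real.rpow_nonneg hL0.le _
    have htot : L ^ (cZero - 3 * ε) * ((r : ℝ) * M + ((2 * (A + 1) : ℕ) : ℝ))
        + ((2 * (A + 1) : ℕ) : ℝ) ≤ 2 * C₂ * Z := by
      have h1 := mul_le_mul_of_nonneg_left hcost hQ0
      have h2 : L ^ (cZero - 3 * ε) * (C₂ * a) = C₂ * Z := by rw [← hQa]; ring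
      have h3 : ((2 * (A + 1) : ℕ) : ℝ) ≤ C₂ * Z := by
        have h4 := mul_le_mul_of_nonneg_left hZa (show 0 ≤ C₂ by linarith)
        have h5 : 0 ≤ (r : ℝ) * M := by positivity
        linarith
      linarith
    refine carriesLength_of_scales hr hs le_rfl hπT hπ ρ (L ^ ε) ?_ ?_ ?_ ?_ ?_ ?_ ?_ ?_
    · intro i _
      linarith [hρa i]
    · intro i hi
      refine (mul_le_mul_of_nonneg_left (hρle i hi) (by norm_num)).trans (hRbig 12 ?_)
      linarith
    · intro i _
      have h1 : ρ (i + 1) = L ^ θ * ρ i := by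
        simp only [hρ]
        rw [← Real.rpow_add hL0]
        congr 1
        push_cast
        ring
      rw [h1]
      exact mul_le_mul_of_nonneg_right (hmono hθε) (by linarith [hρa i])
    · rw [hρ0, ← hNdef]
      refine le_trans ?_ hN'
      have h1 : (2 * (r : ℝ) + 1) ^ ⌊a⌋₊ ≤ (2 : ℝ) ^ ((4 * I + 10) * a) := by
        have h2 : 2 * (r : ℝ) + 1 ≤ (2 : ℝ) ^ ((4 * I + 10 : ℕ) : ℝ) := by
          rw [Real.rpow_natCast]
          have h3 : (16 : ℝ) ^ (I + 2) = 2 ^ (4 * I + 8) := by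
            rw [show (16 : ℝ) = 2 ^ 4 by norm_num, ← pow_mul]
            ring_nf
          have h4 : (1 : ℝ) ≤ 2 ^ (4 * I + 8) := one_le_pow₀ (by norm_num)
          rw [show 4 * I + 10 = (4 * I + 8) + 2 by ring, pow_add (2 : ℝ) (4 * I + 8) 2]
          rw [hrR, h3]
          linarith
        calc (2 * (r : ℝ) + 1) ^ ⌊a⌋₊
            ≤ ((2 : ℝ) ^ ((4 * I + 10 : ℕ) : ℝ)) ^ ⌊a⌋₊ := pow_le_pow_left₀ (by positivity) h2 _
          _ = (2 : ℝ) ^ (((4 * I + 10 : ℕ) : ℝ) * ⌊a⌋₊) := by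
              rw [Real.rpow_mul (by norm_num), Real.rpow_natCast _ ⌊a⌋₊]
          _ ≤ _ := by
              refine Real.rpow_le_rpow_of_exponent_le (by norm_num) ?_
              push_cast
              exact mul_le_mul_of_nonneg_left (Nat.floor_le (by linarith)) (by positivity)
      have h2 : (2 : ℝ) ≤ 2 ^ a := by
        calc (2 : ℝ) = 2 ^ (1 : ℝ) := (Real.rpow_one 2).symm
          _ ≤ _ := Real.rpow_le_rpow_of_exponent_le (by norm_num) (by linarith)
      calc _ ≤ (2 : ℝ) ^ a * (k * (2 : ℝ) ^ a * (2 : ℝ) ^ ((4 * I + 10) * a)) := by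
            refine mul_le_mul h2 (mul_le_mul hF' h1 (by positivity) (by positivity))
              (by positivity) (by positivity)
        _ = k * ((2 : ℝ) ^ a * (2 : ℝ) ^ a * (2 : ℝ) ^ ((4 * I + 10) * a)) := by ring
        _ = k * (2 : ℝ) ^ ((4 * I + 12) * a) := by
            rw [← Real.rpow_add (by norm_num), ← Real.rpow_add (by norm_num)]
            congr 2
            ring
    · rw [← hNdef]
      refine le_trans ?_ hN'
      calc (R * partitionSize F : ℝ) ≤ (2 : ℝ) ^ a * (k * (2 : ℝ) ^ a) :=
            mul_le_mul (hRL.trans hL2a) hF' (Nat.cast_nonneg _) (by positivity)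
        _ = k * (2 : ℝ) ^ (a + a) := by
            rw [Real.rpow_add (by norm_num)]
            ring
        _ ≤ _ := by
            refine mul_le_mul_of_nonneg_left (Real.rpow_le_rpow_of_exponent_le (by norm_num) ?_)
              (Nat.cast_nonneg _)
            have : 0 ≤ (I : ℝ) * a := by positivity
            linarith
    · intro i _
      calc (R : ℝ) ≤ L := hRL
        _ = L / a * a := by field_simp
        _ ≤ M * ρ i := mul_le_mul hMge (hρa i) (by linarith) M.2
    · rw [hvol, ← hNdef, mul_left_comm]
      refine mul_le_mul_of_nonneg_left ?_ hN0.le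
      rw [le_sub_iff_add_le]
      refine htot.trans ?_
      rw [hρI, le_div_iff₀ (by positivity), ← hZε]
      have h1 : 8 * 16 ^ I * C₂ ≤ L ^ ε := by
        refine le_trans ?_ hK'
        have h2 := mul_le_mul_of_nonneg_right hc100 (show 0 ≤ 16 ^ I * C₂ by positivity)
        have h3 : 0 ≤ 16 ^ I * C₂ := by positivity
        linarith
      have h2 := mul_le_mul_of_nonneg_left h1 hZ0.le
      linarith
    · rw [hvol, ← hNdef, mul_left_comm]
      refine mul_le_mul_of_nonneg_left ?_ hN0.le
      rw [le_sub_iff_add_le]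
      refine htot.trans ?_
      have hLε : 0 < L ^ ε := Real.rpow_pos_of_pos hL0 _
      rw [le_div_iff₀ (by positivity)]
      refine le_trans ?_ hRge
      rw [le_div_iff₀ (by positivity)]
      have h2 := mul_le_mul_of_nonneg_left hK' hL1ε.le
      rw [hsplit, ← hZε] at h2
      linarith

theorem theorem1p1 :
    ∃ C : ℝ, 0 < C ∧ ∃ ε₀ : ℝ, 0 < ε₀ ∧ ∀ ε : ℝ, 0 < ε → ε < ε₀ →
      ∃ k₀ : ℕ, ∀ k : ℕ, k₀ ≤ k →
        ∃ (V E : Type) (_ : Fintype V) (_ : Fintype E) (G : CapGraph V E) (T : Finset V),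
          (∀ e, 1 ≤ G.cap e) ∧ T.card = k ∧
          (∀ F : Setoid V, ValidPartition T F → (partitionSize F : ℝ) ≤ sizeBound k ε →
            ∀ q : ℝ,
              G.IsFlowSparsifier (fun t : T => t.1) (G.contract F) (contractTerminal T F) q →
              Real.logb 2 (k : ℝ) ^ (cZero - C * ε) ≤ q) ∧
          (∀ μ : PMF {F : Setoid V // ValidPartition T F},
            (∀ F ∈ μ.support, (partitionSize F.1 : ℝ) ≤ sizeBound k ε) →
            ∀ q : ℝ,
              G.IsFlowSparsifier (fun t : T => t.1) (mixtureGraph G T μ) (mixtureTerminal T μ) q →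
              Real.logb 2 (k : ℝ) ^ (cZero - C * ε) ≤ q) := by
  refine ⟨3, by norm_num, 1 / 16, by norm_num, fun ε hε hε' => ?_⟩
  have hlog : Filter.Tendsto (fun k : ℕ => Real.logb 2 (k : ℝ)) Filter.atTop Filter.atTop :=
    (Real.tendsto_logb_atTop (by norm_num)).comp tendsto_natCast_atTop_atTop
  obtain ⟨k₀, hk₀⟩ := Filter.eventually_atTop.1 ((hlog.eventually_ge_atTop 1).and
    (((tendsto_rpow_atTop hε).comp hlog).eventually_ge_atTop (scaleThreshold ⌈1 / ε⌉₊)))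
  refine ⟨k₀, fun k hk => ?_⟩
  obtain ⟨h1, h2⟩ := hk₀ k hk
  obtain ⟨V, E, _, _, G, T, dist, len, hcap, hT, hsymm, hd, hpos, hcarry⟩ :=
    exists_hard_graph hε hε' (Nat.le_ceil _) rfl h1 h2
  exact ⟨V, E, ‹_›, ‹_›, G, T, hcap, hT,
    contraction_and_mixture_bound G T dist hsymm len hd hpos hcarry⟩
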